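/- Let $\mathcal X,\mathcal Y$ be finite-dimensional real inner product spaces, let $f:\mathcal X\to\mathbb R\cup\{\infty\}$ and $g:\mathcal Y\to\mathbb R\cup\{\infty\}$ be proper, closed and convex (convexity moduli $\mu_x=\mu_y=0$), and let $\Phi:\mathcal X\times\mathcal Y\to\mathbb R$ be such that $\Phi(\cdot,y)$ is convex and differentiable for every $y\in\operatorname{dom} g$, $\Phi(x,\cdot)$ is concave and differentiable for every $x\in\operatorname{dom} f$, and, for some $L_{xx},L_{yy}\ge 0$ and $L_{xy},L_{yx}>0$, $$\|\nabla_x\Phi(x,y)-\nabla_x\Phi(x',y')\|\le L_{xx}\|x-x'\|+L_{xy}\|y-y'\|,\qquad \|\nabla_y\Phi(x,y)-\nabla_y\Phi(x',y')\|\le L_{yx}\|x-x'\|+L_{yy}\|y-y'\|$$ for all $x,x'\in\operatorname{dom} f$ and $y,y'\in\operatorname{dom} g$. Put $\mathcal L(x,y)=f(x)+\Phi(x,y)-g(y)$. Assume that $\operatorname{dom} f\times\operatorname{dom} g$ is compact, and let $\Omega_f,\Omega_g>0$ satisfy $\|x-x'\|^2\le\Omega_f$ on $\operatorname{dom} f$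 and $\|y-y'\|^2\le\Omega_g$ on $\operatorname{dom} g$. Given $(x_0,y_0)\in\operatorname{dom} f\times\operatorname{dom} g$, step sizes $\tau,\sigma>0$, a momentum parameter $\theta$, measurable stochastic oracles $\tilde\nabla_x\Phi(x,y;\omega^x)$ and $\tilde\nabla_y\Phi(x,y;\omega^y)$, and random samples $(\omega^x_k)_{k\ge 0}$ and $(\omega^y_k)_{k\ge -1}$, the SAPD iterates are defined by $(x_{-1},y_{-1})=(x_0,y_0)$ and, for $k\ge 0$, $$\tilde q_k=\tilde\nabla_y\Phi(x_k,y_k;\omega^y_k)-\tilde\nabla_y\Phi(x_{k-1},y_{k-1};\omega^y_{k-1}),\qquad \tilde s_k=\tilde\nabla_y\Phi(x_k,y_k;\omega^y_k)+\theta\tilde q_k,$$ $$y_{k+1}=\operatorname{prox}_{\sigma g}(y_k+\sigma\tilde s_k),\qquad x_{k+1}=\operatorname{prox}_{\tau f}\big(x_k-\tau\tilde\nabla_x\Phi(x_k,y_{k+1};\omega^x_k)\big),$$ where $\operatorname{prox}_h(v)=\arg\min_u\{h(u)+\tfrac12\|v-u\|^2\}$. Let $(\bar x_N,\bar y_N)=\frac1N\sum_{k=1}^N(x_k,y_k)$.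 Let $\epsilon>0$ and $\delta_x,\delta_y\ge 0$, and choose, with the convention $\epsilon/0=\infty$, $$\tau=\min\Big\{\frac1{L_{yx}+L_{xx}},\ \frac{2}{15}\cdot\frac{\epsilon}{\delta_x^2}\Big\},\qquad \sigma=\min\Big\{\frac1{L_{yx}+2L_{yy}},\ \frac1{L_{xy}},\ \frac1{72}\cdot\frac{\epsilon}{\delta_y^2}\Big\},\qquad \theta=1.$$ Assume that, for the iterates generated with these parameters, the samples $(\omega^x_k)_{k}$ are independent, the samples $(\omega^y_k)_{k}$ are independent, the two sequences are independent of each other, and $$\mathbb E[\tilde\nabla_x\Phi(x_k,y_{k+1};\omega^x_k)\mid x_k,y_{k+1}]=\nabla_x\Phi(x_k,y_{k+1}),\qquad \mathbb E[\|\tilde\nabla_x\Phi(x_k,y_{k+1};\omega^x_k)-\nabla_x\Phi(x_k,y_{k+1})\|^2\mid x_k,y_{k+1}]\le\delta_x^2\qquad(k\ge 0),$$ $$\mathbb E[\tilde\nabla_y\Phi(x_k,y_k;\omega^y_k)\mid x_k,y_k]=\nabla_y\Phi(x_k,y_k),\qquad \mathbb E[\|\tilde\nabla_y\Phi(x_k,y_k;\omega^y_k)-\nabla_y\Phi(x_k,y_k)\|^2\mid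 x_k,y_k]\le\delta_y^2\qquad(k\ge -1).$$ Then there is a universal constant $C>0$ (independent of all the data above) such that for every integer $$N\ \ge\ C\Big(\frac{(L_{yx}+L_{xx})\Omega_f+\max\{L_{yx}+L_{yy},\,L_{xy}\}\,\Omega_g}{\epsilon}+\frac{\delta_x^2\Omega_f+\delta_y^2\Omega_g}{\epsilon^2}\Big)$$ the gap function satisfies $$\mathcal G(\bar x_N,\bar y_N)=\mathbb E\Big[\sup_{(x,y)\in\mathcal X\times\mathcal Y}\{\mathcal L(\bar x_N,y)-\mathcal L(x,\bar y_N)\}\Big]\le\epsilon .$$ -/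

import Mathlib

open MeasureTheory ProbabilityTheory Set

noncomputable section

namespace SAPD

section Convex

variable {E : Type*} [NormedAddCommGroup E] [InnerProductSpace ℝ E]

/-- The effective domain of an extended-real-valued function. -/
def effDom (h : E → EReal) : Set E := {x | h x ≠ ⊤}

/-- `h : E → ℝ ∪ {+∞}` is proper, closed (lower semicontinuous) and convex (convex epigraph). -/
structure IsProperClosedConvex (h : E → EReal) : Prop where
  ne_bot : ∀ x, h x ≠ ⊥
  nonempty : (effDom h).Nonempty
  lsc : LowerSemicontinuous h
  convex : Convex ℝ {p : E × ℝ | h p.1 ≤ (p.2 : EReal)}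

/-- The proximal operator: a point `u` (unique when `h` is proper, closed and convex) that minimizes
`h u + ‖v - u‖ ^ 2 / 2` over the whole space. -/
def prox (h : E → EReal) (v : E) : E :=
  Classical.epsilon fun u : E =>
    IsMinOn (fun w : E => h w + ((‖v - w‖ ^ 2 / 2 : ℝ) : EReal)) univ u

end Convex

section Problem

variable {X Y : Type*}
  [NormedAddCommGroup X] [InnerProductSpace ℝ X]
  [NormedAddCommGroup Y] [InnerProductSpace ℝ Y]

/-- The partial gradient of `Φ` in its first argument. -/
def gradX [FiniteDimensional ℝ X] (Φ : X → Y → ℝ) (x : X) (y : Y) : X :=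
  haveI : CompleteSpace X := FiniteDimensional.complete ℝ X
  gradient (fun u => Φ u y) x

/-- The partial gradient of `Φ` in its second argument. -/
def gradY [FiniteDimensional ℝ Y] (Φ : X → Y → ℝ) (x : X) (y : Y) : Y :=
  haveI : CompleteSpace Y := FiniteDimensional.complete ℝ Y
  gradient (fun v => Φ x v) y

/-- `f` and `g` are proper, closed and convex; `Φ` is convex-concave and differentiable in each
argument, and its partial gradients are Lipschitz on `dom f × dom g` with the given block
constants. -/
structure IsSmoothConvexConcave [FiniteDimensional ℝ X] [FiniteDimensional ℝ Y]
    (f : X → EReal) (g : Y → EReal) (Φ : X → Y → ℝ) (Lxx Lxy Lyx Lyy : ℝ) : Prop where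
  f_convex : IsProperClosedConvex f
  g_convex : IsProperClosedConvex g
  Lxx_nonneg : 0 ≤ Lxx
  Lxy_pos : 0 < Lxy
  Lyx_pos : 0 < Lyx
  Lyy_nonneg : 0 ≤ Lyy
  convex_x : ∀ y ∈ effDom g, ConvexOn ℝ univ (fun x => Φ x y)
  differentiable_x : ∀ y ∈ effDom g, Differentiable ℝ (fun x => Φ x y)
  concave_y : ∀ x ∈ effDom f, ConcaveOn ℝ univ (fun y => Φ x y)
  differentiable_y : ∀ x ∈ effDom f, Differentiable ℝ (fun y => Φ x y)
  lipschitz_x : ∀ x ∈ effDom f, ∀ x' ∈ effDom f, ∀ y ∈ effDom g, ∀ y' ∈ effDom g,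
    ‖gradX Φ x y - gradX Φ x' y'‖ ≤ Lxx * ‖x - x'‖ + Lxy * ‖y - y'‖
  lipschitz_y : ∀ x ∈ effDom f, ∀ x' ∈ effDom f, ∀ y ∈ effDom g, ∀ y' ∈ effDom g,
    ‖gradY Φ x y - gradY Φ x' y'‖ ≤ Lyx * ‖x - x'‖ + Lyy * ‖y - y'‖

/-- `dom f × dom g` is compact, and `Ωf`, `Ωg` bound the squared diameters of the two domains. -/
structure HasCompactDomains (f : X → EReal) (g : Y → EReal) (Ωf Ωg : ℝ) : Prop where
  compact : IsCompact (effDom f ×ˢ effDom g)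
  Ωf_pos : 0 < Ωf
  Ωg_pos : 0 < Ωg
  diam_f : ∀ x ∈ effDom f, ∀ x' ∈ effDom f, ‖x - x'‖ ^ 2 ≤ Ωf
  diam_g : ∀ y ∈ effDom g, ∀ y' ∈ effDom g, ‖y - y'‖ ^ 2 ≤ Ωg

/-- The saddle function `f x + Φ x y - g y`. -/
def lagrangian (f : X → EReal) (g : Y → EReal) (Φ : X → Y → ℝ) (x : X) (y : Y) : EReal :=
  f x + (Φ x y : EReal) - g y

/-- `sup { 𝓛(x̄, y) - 𝓛(x, ȳ) }` over all `(x, y) ∈ X × Y`. For `x̄ ∈ dom f` and `ȳ ∈ dom g` the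
supremum is nonnegative (take `(x, y) = (x̄, ȳ)`), so that it is a number in `[0, ∞]`. -/
def primalDualGap (f : X → EReal) (g : Y → EReal) (Φ : X → Y → ℝ) (xbar : X) (ybar : Y) :
    ENNReal :=
  (⨆ (x : X) (y : Y), (lagrangian f g Φ xbar y - lagrangian f g Φ x ybar)).toENNReal

/-- The gap function of a random point: the expectation of the primal-dual gap. -/
def expectedGap {S : Type*} [MeasurableSpace S] (P : Measure S)
    (f : X → EReal) (g : Y → EReal) (Φ : X → Y → ℝ) (xbar : S → X) (ybar : S → Y) : ENNReal :=
  ∫⁻ s, primalDualGap f g Φ (xbar s) (ybar s) ∂P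

end Problem

section Algorithm

variable {X Y Wx Wy : Type*}
  [NormedAddCommGroup X] [InnerProductSpace ℝ X]
  [NormedAddCommGroup Y] [InnerProductSpace ℝ Y]

/-- One iteration: from `z₋ = (x_{k-1}, y_{k-1})`, `z = (x_k, y_k)` and the samples
`wy₋ = ω^y_{k-1}`, `wy = ω^y_k`, `wx = ω^x_k` compute `(x_{k+1}, y_{k+1})`. -/
def step (f : X → EReal) (g : Y → EReal) (Gx : X → Y → Wx → X) (Gy : X → Y → Wy → Y)
    (τ σ θ : ℝ) (zprev z : X × Y) (wyprev wy : Wy) (wx : Wx) : X × Y :=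
  let q : Y := Gy z.1 z.2 wy - Gy zprev.1 zprev.2 wyprev
  let s : Y := Gy z.1 z.2 wy + θ • q
  let y' : Y := prox (fun v => (σ : EReal) * g v) (z.2 + σ • s)
  let x' : X := prox (fun u => (τ : EReal) * f u) (z.1 - τ • Gx z.1 y' wx)
  (x', y')

/-- The iterates of SAPD along the sample sequences `wx`, `wy`. The index is shifted by one so that
it starts at time `-1`: `iterate … n` is `(x_{n-1}, y_{n-1})` and `wy n` is the sample `ω^y_{n-1}`;
`wx n` is `ω^x_n`. Thus `(x_{-1}, y_{-1}) = (x_0, y_0)` are the entries `0` and `1`. -/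
def iterate (f : X → EReal) (g : Y → EReal) (Gx : X → Y → Wx → X) (Gy : X → Y → Wy → Y)
    (τ σ θ : ℝ) (x₀ : X) (y₀ : Y) (wx : ℕ → Wx) (wy : ℕ → Wy) : ℕ → X × Y
  | 0 => (x₀, y₀)
  | 1 => (x₀, y₀)
  | n + 2 => step f g Gx Gy τ σ θ
      (iterate f g Gx Gy τ σ θ x₀ y₀ wx wy n) (iterate f g Gx Gy τ σ θ x₀ y₀ wx wy (n + 1))
      (wy n) (wy (n + 1)) (wx n)

/-- The sequence `n ↦ (x_{n-1}, y_{n-1})` of random iterates. -/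
def process {S : Type*} (f : X → EReal) (g : Y → EReal)
    (Gx : X → Y → Wx → X) (Gy : X → Y → Wy → Y) (τ σ θ : ℝ) (x₀ : X) (y₀ : Y)
    (ωx : ℕ → S → Wx) (ωy : ℕ → S → Wy) (n : ℕ) (s : S) : X × Y :=
  iterate f g Gx Gy τ σ θ x₀ y₀ (fun k => ωx k s) (fun k => ωy k s) n

/-- The average `(1 / N) ∑_{k=1}^N (x_k, y_k)` of a sequence given as `z n = (x_{n-1}, y_{n-1})`. -/
def ergodicAverage {S : Type*} (z : ℕ → S → X × Y) (N : ℕ) (s : S) : X × Y :=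
  (1 / (N : ℝ)) • ∑ k ∈ Finset.Icc 1 N, z (k + 1) s

/-- The primal step size `min {1 / (Lyx + Lxx), (2 / 15) ε / δx²}`, where `ε / 0 = ∞`. -/
def tauMC (Lxx Lyx δx ε : ℝ) : ℝ :=
  if δx = 0 then 1 / (Lyx + Lxx) else min (1 / (Lyx + Lxx)) (2 / 15 * (ε / δx ^ 2))

/-- The dual step size `min {1 / (Lyx + 2 Lyy), 1 / Lxy, (1 / 72) ε / δy²}`, where `ε / 0 = ∞`. -/
def sigmaMC (Lxy Lyx Lyy δy ε : ℝ) : ℝ :=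
  if δy = 0 then min (1 / (Lyx + 2 * Lyy)) (1 / Lxy)
  else min (min (1 / (Lyx + 2 * Lyy)) (1 / Lxy)) (1 / 72 * (ε / δy ^ 2))

end Algorithm

section Noise

variable {X Y Wx Wy S : Type*}
  [NormedAddCommGroup X] [InnerProductSpace ℝ X] [FiniteDimensional ℝ X]
  [MeasurableSpace X] [BorelSpace X]
  [NormedAddCommGroup Y] [InnerProductSpace ℝ Y] [FiniteDimensional ℝ Y]
  [MeasurableSpace Y] [BorelSpace Y]
  [MeasurableSpace Wx] [MeasurableSpace Wy] [MeasurableSpace S]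

/-- The stochastic first-order oracles `Gx`, `Gy` are measurable, driven by independent samples,
and, along the iterates `z n = (x_{n-1}, y_{n-1})`, conditionally unbiased with conditional variances
at most `δx²`, `δy²`. In the shifted indexing `(z (k + 1)).1 = x_k`, `(z (k + 2)).2 = y_{k+1}`, and
`ωy n` is the sample used at `z n`, for all times `n - 1 ≥ -1`. Conditional expectations are taken of
integrable functions only. -/
structure IsUnbiasedBoundedNoise (P : Measure S) (Φ : X → Y → ℝ)
    (Gx : X → Y → Wx → X) (Gy : X → Y → Wy → Y)
    (ωx : ℕ → S → Wx) (ωy : ℕ → S → Wy) (z : ℕ → S → X × Y) (δx δy : ℝ) : Prop where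
  δx_nonneg : 0 ≤ δx
  δy_nonneg : 0 ≤ δy
  measurable_Gx : Measurable fun p : X × Y × Wx => Gx p.1 p.2.1 p.2.2
  measurable_Gy : Measurable fun p : X × Y × Wy => Gy p.1 p.2.1 p.2.2
  measurable_ωx : ∀ k, Measurable (ωx k)
  measurable_ωy : ∀ n, Measurable (ωy n)
  indep_x : iIndepFun ωx P
  indep_y : iIndepFun ωy P
  indep_xy : IndepFun (fun s k => ωx k s) (fun s n => ωy n s) P
  integrable_x : ∀ k, Integrable (fun s => Gx (z (k + 1) s).1 (z (k + 2) s).2 (ωx k s)) P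
  integrable_y : ∀ n, Integrable (fun s => Gy (z n s).1 (z n s).2 (ωy n s)) P
  unbiased_x : ∀ k,
    P[fun s => Gx (z (k + 1) s).1 (z (k + 2) s).2 (ωx k s) |
        MeasurableSpace.comap (fun s => ((z (k + 1) s).1, (z (k + 2) s).2)) inferInstance]
      =ᵐ[P] fun s => gradX Φ (z (k + 1) s).1 (z (k + 2) s).2
  unbiased_y : ∀ n,
    P[fun s => Gy (z n s).1 (z n s).2 (ωy n s) | MeasurableSpace.comap (z n) inferInstance]
      =ᵐ[P] fun s => gradY Φ (z n s).1 (z n s).2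
  sq_integrable_x : ∀ k, Integrable (fun s =>
    ‖Gx (z (k + 1) s).1 (z (k + 2) s).2 (ωx k s) - gradX Φ (z (k + 1) s).1 (z (k + 2) s).2‖ ^ 2) P
  sq_integrable_y : ∀ n, Integrable (fun s =>
    ‖Gy (z n s).1 (z n s).2 (ωy n s) - gradY Φ (z n s).1 (z n s).2‖ ^ 2) P
  variance_x : ∀ k,
    P[fun s => ‖Gx (z (k + 1) s).1 (z (k + 2) s).2 (ωx k s)
          - gradX Φ (z (k + 1) s).1 (z (k + 2) s).2‖ ^ 2 |
        MeasurableSpace.comap (fun s => ((z (k + 1) s).1, (z (k + 2) s).2)) inferInstance]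
      ≤ᵐ[P] fun _ => δx ^ 2
  variance_y : ∀ n,
    P[fun s => ‖Gy (z n s).1 (z n s).2 (ωy n s) - gradY Φ (z n s).1 (z n s).2‖ ^ 2 |
        MeasurableSpace.comap (z n) inferInstance]
      ≤ᵐ[P] fun _ => δy ^ 2

end Noise

end SAPD

end

set_option linter.unusedSectionVars false

/-! Fix a comparison point `(u, v)` in the two domains. The three-point inequalities of the two
proximal steps, convexity-concavity of `Φ` and the descent lemma in `x` bound the gap of a new
iterate against `(u, v)` by the decrease of `potential` plus inner products of oracle errors with
the iterate minus `(u, v)` (`lagrangian_gap_step_le`). Because the momentum is one, the differences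
of dual gradients telescope, and the step sizes absorb the remaining squares. As `potential` is
nonnegative, summation and Jensen's inequality bound the gap at the average by initial distances and
noise.

The supremum stands inside the expectation, so `(u, v)` may depend on the noise. The errors are
therefore paired with the iterate and with `(u, v)` separately, both measured from the starting
point. The second pairing is linear in `(u, v)`, with the total error as coefficient: Young's
inequality and the diameters remove `(u, v)`, and since successive errors are orthogonal in mean,
the squared norm of their sum has mean at most the sum of the variances.

In the first pairing the iterate depends on the very sample whose error it meets. It is replaced by
a "hat" iterate in which the offending oracle outputs become exact gradients. A hat iterate is a
function of the past, so its pairing has mean zero, while nonexpansiveness of the proximal maps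
makes the replacement cost only step size times squared errors (`noise_step_le`).

Altogether the expected gap is at most `5/2 τ δx² + 21 σ δy² + (Ωf/τ + Ωg/σ)/N`
(`IsStochasticTrajectory.expectedGap_le`). The prescribed step sizes make the noise part at most
`5/8 ε`, and a large `N` makes the last part small. -/

namespace SAPD

open scoped InnerProductSpace Topology

/-! ### First-order inequalities for convex and for smooth functions. -/

section Calculus

variable {E : Type*} [NormedAddCommGroup E] [InnerProductSpace ℝ E]

/-- The segment `t ↦ x + t (u - x)` composed with a differentiable function. -/
theorem hasDerivAt_comp_segment {F : E → ℝ} {x u : E} {t : ℝ} {L : E →L[ℝ] ℝ}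
    (hL : HasFDerivAt F L (x + t • (u - x))) :
    HasDerivAt (fun t : ℝ => F (x + t • (u - x))) (L (u - x)) t := by
  have h1 : HasDerivAt (fun t : ℝ => x + t • (u - x)) (u - x) t := by
    simpa using ((hasDerivAt_id t).smul_const (u - x)).const_add x
  exact hL.comp_hasDerivAt t h1

/-- First-order lower bound for a convex function. -/
theorem convexOn_add_fderiv_le {F : E → ℝ} (hF : ConvexOn ℝ univ F) {x : E} {L : E →L[ℝ] ℝ}
    (hL : HasFDerivAt F L x) (u : E) : F x + L (u - x) ≤ F u := by
  have hc : ConvexOn ℝ univ (fun t : ℝ => F (x + t • (u - x))) := by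
    have := hF.comp_affineMap (AffineMap.lineMap x u)
    refine (by simpa using this : ConvexOn ℝ univ (F ∘ (AffineMap.lineMap x u))).congr ?_
    intro t _
    simp [AffineMap.lineMap_apply, add_comm]
  have hd : HasDerivAt (fun t : ℝ => F (x + t • (u - x))) (L (u - x)) 0 :=
    hasDerivAt_comp_segment (by simpa using hL)
  have := hc.le_slope_of_hasDerivAt (mem_univ 0) (mem_univ 1) one_pos hd
  simp [slope_def_field] at this
  rw [map_sub]
  linarith

/-- The descent lemma on a convex set. -/
theorem descent_lemma {D : Set E} (hD : Convex ℝ D) {F : E → ℝ} {G : E → E} {L : ℝ}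
    (hG : ∀ x ∈ D, HasFDerivAt F (innerSL ℝ (G x)) x)
    (hL : ∀ x ∈ D, ∀ x' ∈ D, ‖G x - G x'‖ ≤ L * ‖x - x'‖) {x u : E} (hx : x ∈ D) (hu : u ∈ D) :
    F u ≤ F x + ⟪G x, u - x⟫_ℝ + L / 2 * ‖u - x‖ ^ 2 := by
  have hmem : ∀ t ∈ Icc (0 : ℝ) 1, x + t • (u - x) ∈ D := fun t ht =>
    hD.add_smul_sub_mem hx hu ht
  -- The claim is `φ 1 ≤ φ 0`; the Lipschitz bound on `G` says exactly that `φ` has nonpositive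
  -- derivative.
  let φ : ℝ → ℝ := fun t => F (x + t • (u - x)) - t * ⟪G x, u - x⟫_ℝ - L / 2 * ‖u - x‖ ^ 2 * t ^ 2
  have hd : ∀ t ∈ Icc (0 : ℝ) 1, HasDerivAt φ
      (⟪G (x + t • (u - x)), u - x⟫_ℝ - ⟪G x, u - x⟫_ℝ - L * ‖u - x‖ ^ 2 * t) t := by
    intro t ht
    have h1 := hasDerivAt_comp_segment (hG _ (hmem t ht))
    have h2 := (hasDerivAt_id t).mul_const ⟪G x, u - x⟫_ℝ
    have h3 := ((hasDerivAt_id t).pow 2).const_mul (L / 2 * ‖u - x‖ ^ 2)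
    refine ((h1.sub h2).sub h3).congr_deriv ?_
    simp
    ring
  have hanti : AntitoneOn φ (Icc 0 1) := by
    refine antitoneOn_of_deriv_nonpos (convex_Icc 0 1)
      (fun t ht => (hd t ht).continuousAt.continuousWithinAt) ?_ ?_
    · intro t ht
      rw [interior_Icc] at ht
      exact (hd t (Ioo_subset_Icc_self ht)).differentiableAt.differentiableWithinAt
    · intro t ht
      rw [interior_Icc] at ht
      have ht' := Ioo_subset_Icc_self ht
      rw [(hd t ht').deriv, ← inner_sub_left]
      have h1 := real_inner_le_norm (G (x + t • (u - x)) - G x) (u - x)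
      have h2 := hL _ (hmem t ht') _ hx
      rw [add_sub_cancel_left, norm_smul, Real.norm_of_nonneg ht'.1] at h2
      nlinarith [norm_nonneg (u - x)]
  have := hanti (left_mem_Icc.2 zero_le_one) (right_mem_Icc.2 zero_le_one) zero_le_one
  simp only [φ] at this
  simp at this
  linarith

end Calculus

/-! ### Proximal maps on a compact domain. -/

section Prox

variable {E : Type*} [NormedAddCommGroup E] [InnerProductSpace ℝ E]

theorem IsProperClosedConvex.coe_toReal {h : E → EReal} (hh : IsProperClosedConvex h) {x : E}
    (hx : x ∈ effDom h) : ((h x).toReal : EReal) = h x :=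
  EReal.coe_toReal hx (hh.ne_bot x)

/-- The points `(x, h x)` and `(y, h y)` lie in the convex epigraph, hence so does their
combination. -/
theorem IsProperClosedConvex.convexOn {h : E → EReal} (hh : IsProperClosedConvex h) :
    ConvexOn ℝ (effDom h) fun x => (h x).toReal := by
  have key : ∀ x ∈ effDom h, ∀ y ∈ effDom h, ∀ a b : ℝ, 0 ≤ a → 0 ≤ b → a + b = 1 →
      h (a • x + b • y) ≤ ((a * (h x).toReal + b * (h y).toReal : ℝ) : EReal) := by
    intro x hx y hy a b ha hb hab
    have h1 : (x, (h x).toReal) ∈ {p : E × ℝ | h p.1 ≤ (p.2 : EReal)} := (hh.coe_toReal hx).ge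
    have h2 : (y, (h y).toReal) ∈ {p : E × ℝ | h p.1 ≤ (p.2 : EReal)} := (hh.coe_toReal hy).ge
    simpa using hh.convex h1 h2 ha hb hab
  have hmem : Convex ℝ (effDom h) := fun x hx y hy a b ha hb hab =>
    ((key x hx y hy a b ha hb hab).trans_lt (EReal.coe_lt_top _)).ne
  refine ⟨hmem, fun x hx y hy a b ha hb hab => ?_⟩
  have := key x hx y hy a b ha hb hab
  rw [← hh.coe_toReal (hmem hx hy ha hb hab)] at this
  exact_mod_cast this

/-- The proximal point of `c h` exists, lies in the domain and satisfies the variational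
inequality. -/
theorem prox_spec {h : E → EReal} (hh : IsProperClosedConvex h) (hc : IsCompact (effDom h))
    {c : ℝ} (c_pos : 0 < c) (v : E) :
    prox (fun u => (c : EReal) * h u) v ∈ effDom h ∧
    ∀ u ∈ effDom h,
      c * (h (prox (fun u => (c : EReal) * h u) v)).toReal
        + ⟪v - prox (fun u => (c : EReal) * h u) v, u - prox (fun u => (c : EReal) * h u) v⟫_ℝ
      ≤ c * (h u).toReal := by
  set Ψ : E → EReal := fun w => (c : EReal) * h w + ((‖v - w‖ ^ 2 / 2 : ℝ) : EReal) with hΨ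
  have hΨdom : ∀ w ∈ effDom h, Ψ w = ((c * (h w).toReal + ‖v - w‖ ^ 2 / 2 : ℝ) : EReal) := by
    intro w hw
    simp only [hΨ]
    rw [← hh.coe_toReal hw]
    norm_cast
  have hΨtop : ∀ w ∉ effDom h, Ψ w = ⊤ := by
    intro w hw
    have : h w = ⊤ := by simpa [effDom] using hw
    simp only [hΨ]
    rw [this, EReal.coe_mul_top_of_pos c_pos, EReal.top_add_coe]
  -- The objective is divided by `c`, so that lower semicontinuity is needed for `h` itself and not
  -- for its extended-real multiple.
  obtain ⟨p, hp, hpmin⟩ : ∃ p ∈ effDom h,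
      IsMinOn (fun w => h w + ((‖v - w‖ ^ 2 / (2 * c) : ℝ) : EReal)) (effDom h) p := by
    refine LowerSemicontinuousOn.exists_isMinOn hh.nonempty hc ?_
    refine LowerSemicontinuous.lowerSemicontinuousOn ?_ _
    refine hh.lsc.add' (Continuous.lowerSemicontinuous ?_) ?_
    · exact continuous_coe_real_ereal.comp (by fun_prop)
    · intro w
      exact EReal.continuousAt_add (Or.inr (EReal.coe_ne_bot _)) (Or.inr (EReal.coe_ne_top _))
  have hex : ∃ p, IsMinOn Ψ univ p := by
    refine ⟨p, fun w _ => ?_⟩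
    by_cases hw : w ∈ effDom h
    · have := hpmin hw
      simp only [mem_ofPred_eq] at this ⊢
      rw [hΨdom p hp, hΨdom w hw, EReal.coe_le_coe_iff]
      rw [← hh.coe_toReal hp, ← hh.coe_toReal hw] at this
      norm_cast at this
      have h2 := mul_le_mul_of_nonneg_left this c_pos.le
      have e : ∀ r : ℝ, c * (r / (2 * c)) = r / 2 := fun r => by field_simp
      rw [mul_add, mul_add, e, e] at h2
      exact h2
    · simp [hΨtop w hw]
  -- `prox` is a choice operator and is a minimizer only because one has been shown to exist.
  have hmin : IsMinOn Ψ univ (prox (fun u => (c : EReal) * h u) v) := Classical.epsilon_spec hex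
  generalize prox (fun u => (c : EReal) * h u) v = q at hmin
  have hq : q ∈ effDom h := by
    by_contra hq
    have := hmin (mem_univ p)
    simp only [mem_ofPred_eq] at this
    rw [hΨtop q hq, hΨdom p hp, top_le_iff] at this
    exact EReal.coe_ne_top _ this
  refine ⟨hq, fun u hu => ?_⟩
  -- First-order optimality: compare `q` with a point at fraction `t` towards `u`, divide by `t`,
  -- and let `t` tend to zero.
  have key : ∀ t ∈ Ioc (0 : ℝ) 1,
      c * (h q).toReal + ⟪v - q, u - q⟫_ℝ - t / 2 * ‖u - q‖ ^ 2 ≤ c * (h u).toReal := by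
    intro t ht
    have hm : q + t • (u - q) ∈ effDom h :=
      hh.convexOn.1.add_smul_sub_mem hq hu ⟨ht.1.le, ht.2⟩
    have h1 := hmin (mem_univ (q + t • (u - q)))
    simp only [mem_ofPred_eq] at h1
    rw [hΨdom q hq, hΨdom _ hm, EReal.coe_le_coe_iff] at h1
    have h2 : (h (q + t • (u - q))).toReal ≤ (1 - t) * (h q).toReal + t * (h u).toReal := by
      have := hh.convexOn.2 hq hu (sub_nonneg.2 ht.2) ht.1.le (by ring)
      simp only [smul_eq_mul] at this
      rwa [show (1 - t) • q + t • u = q + t • (u - q) by module] at this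
    have h3 : ‖v - (q + t • (u - q))‖ ^ 2
        = ‖v - q‖ ^ 2 - 2 * t * ⟪v - q, u - q⟫_ℝ + t ^ 2 * ‖u - q‖ ^ 2 := by
      rw [← sub_sub, norm_sub_sq_real, inner_smul_right, norm_smul, mul_pow, Real.norm_eq_abs,
        sq_abs]
      ring
    rw [h3] at h1
    have h4 := mul_le_mul_of_nonneg_left h2 c_pos.le
    have h5 : t * (c * (h q).toReal + ⟪v - q, u - q⟫_ℝ - t / 2 * ‖u - q‖ ^ 2)
        ≤ t * (c * (h u).toReal) := by nlinarith
    exact le_of_mul_le_mul_left h5 ht.1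
  have hlim : Filter.Tendsto
      (fun t : ℝ => c * (h q).toReal + ⟪v - q, u - q⟫_ℝ - t / 2 * ‖u - q‖ ^ 2) (𝓝[>] 0)
      (𝓝 (c * (h q).toReal + ⟪v - q, u - q⟫_ℝ)) := by
    refine tendsto_nhdsWithin_of_tendsto_nhds ?_
    have : Continuous fun t : ℝ =>
      c * (h q).toReal + ⟪v - q, u - q⟫_ℝ - t / 2 * ‖u - q‖ ^ 2 := by fun_prop
    simpa using this.tendsto 0
  refine le_of_tendsto hlim ?_
  filter_upwards [Ioc_mem_nhdsGT (zero_lt_one' ℝ)] with t ht using key t ht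

variable {h : E → EReal} {c : ℝ}

theorem prox_mem (hh : IsProperClosedConvex h) (hc : IsCompact (effDom h))
    (c_pos : 0 < c) (v : E) : prox (fun u => (c : EReal) * h u) v ∈ effDom h :=
  (prox_spec hh hc c_pos v).1

/-- The proximal map is nonexpansive. -/
theorem norm_prox_sub_prox_le (hh : IsProperClosedConvex h) (hc : IsCompact (effDom h))
    (c_pos : 0 < c) (v w : E) :
    ‖prox (fun u => (c : EReal) * h u) v - prox (fun u => (c : EReal) * h u) w‖ ≤ ‖v - w‖ := by
  obtain ⟨hp, h1⟩ := prox_spec hh hc c_pos v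
  obtain ⟨hq, h2⟩ := prox_spec hh hc c_pos w
  generalize prox (fun u => (c : EReal) * h u) v = p at *
  generalize prox (fun u => (c : EReal) * h u) w = q at *
  have h3 := h1 q hq
  have h4 := h2 p hp
  -- Adding the two variational inequalities, each tested at the other point, cancels the values of
  -- `h`.
  have h5 : ‖p - q‖ ^ 2 ≤ ⟪v - w, p - q⟫_ℝ := by
    have e : ⟪v - p, q - p⟫_ℝ + ⟪w - q, p - q⟫_ℝ = ‖p - q‖ ^ 2 - ⟪v - w, p - q⟫_ℝ := by
      rw [← real_inner_self_eq_norm_sq]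
      simp only [inner_sub_left, inner_sub_right, real_inner_comm]
      ring
    linarith
  have h6 := real_inner_le_norm (v - w) (p - q)
  rcases (norm_nonneg (p - q)).eq_or_lt with h7 | h7
  · rw [← h7]; exact norm_nonneg _
  · refine le_of_mul_le_mul_right ?_ h7
    nlinarith

theorem continuous_prox (hh : IsProperClosedConvex h) (hc : IsCompact (effDom h))
    (c_pos : 0 < c) : Continuous (prox fun u => (c : EReal) * h u) :=
  (LipschitzWith.of_dist_le_mul (K := 1) fun v w => by
    simpa [dist_eq_norm] using norm_prox_sub_prox_le hh hc c_pos v w).continuous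

/-- The three-point inequality for a proximal step along `-d`. -/
theorem prox_three_point (hh : IsProperClosedConvex h) (hc : IsCompact (effDom h))
    (c_pos : 0 < c) (v d : E) {p u : E} (hp : p = prox (fun u => (c : EReal) * h u) (v - c • d))
    (hu : u ∈ effDom h) :
    (h p).toReal + ⟪d, p - u⟫_ℝ
      ≤ (h u).toReal + (‖u - v‖ ^ 2 - ‖u - p‖ ^ 2 - ‖p - v‖ ^ 2) / (2 * c) := by
  have h1 := (prox_spec hh hc c_pos (v - c • d)).2 u hu
  rw [← hp] at h1
  have e : ⟪v - c • d - p, u - p⟫_ℝ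
      = c * ⟪d, p - u⟫_ℝ - (‖u - v‖ ^ 2 - ‖u - p‖ ^ 2 - ‖p - v‖ ^ 2) / 2 := by
    simp only [← real_inner_self_eq_norm_sq, inner_sub_left, inner_sub_right, inner_smul_left,
      real_inner_comm]
    simp
    ring
  rw [e] at h1
  have h2 : (‖u - v‖ ^ 2 - ‖u - p‖ ^ 2 - ‖p - v‖ ^ 2) / 2
      = c * ((‖u - v‖ ^ 2 - ‖u - p‖ ^ 2 - ‖p - v‖ ^ 2) / (2 * c)) := by field_simp
  rw [h2] at h1
  refine le_of_mul_le_mul_left ?_ c_pos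
  linarith

end Prox

/-! ### The deterministic Lyapunov argument along one trajectory. -/

section Pathwise

variable {X Y : Type*}
  [NormedAddCommGroup X] [InnerProductSpace ℝ X] [FiniteDimensional ℝ X]
  [NormedAddCommGroup Y] [InnerProductSpace ℝ Y] [FiniteDimensional ℝ Y]
  {f : X → EReal} {g : Y → EReal} {Φ : X → Y → ℝ} {Lxx Lxy Lyx Lyy : ℝ} {τ σ : ℝ}

theorem IsSmoothConvexConcave.hasFDerivAt_x (H : IsSmoothConvexConcave f g Φ Lxx Lxy Lyx Lyy)
    {y : Y} (hy : y ∈ effDom g) (x : X) :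
    HasFDerivAt (fun u => Φ u y) (innerSL ℝ (gradX Φ x y)) x := by
  have : CompleteSpace X := FiniteDimensional.complete ℝ X
  exact ((H.differentiable_x y hy) x).hasGradientAt.hasFDerivAt

theorem IsSmoothConvexConcave.hasFDerivAt_y (H : IsSmoothConvexConcave f g Φ Lxx Lxy Lyx Lyy)
    {x : X} (hx : x ∈ effDom f) (y : Y) :
    HasFDerivAt (fun v => Φ x v) (innerSL ℝ (gradY Φ x y)) y := by
  have : CompleteSpace Y := FiniteDimensional.complete ℝ Y
  exact ((H.differentiable_y x hx) y).hasGradientAt.hasFDerivAt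

/-- The real-valued saddle function. -/
def realLagrangian (f : X → EReal) (g : Y → EReal) (Φ : X → Y → ℝ) (x : X) (y : Y) : ℝ :=
  (f x).toReal + Φ x y - (g y).toReal

/-- `z` is a trajectory of the primal-dual iteration with momentum one, driven by the dual
gradient estimates `a` and the primal gradient estimates `b`. -/
structure IsTrajectory (f : X → EReal) (g : Y → EReal) (τ σ : ℝ)
    (z : ℕ → X × Y) (a : ℕ → Y) (b : ℕ → X) : Prop where
  init : z 1 = z 0
  mem_f : (z 0).1 ∈ effDom f
  mem_g : (z 0).2 ∈ effDom g
  step_y : ∀ n, (z (n + 2)).2 =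
    prox (fun v => (σ : EReal) * g v) ((z (n + 1)).2 + σ • (a (n + 1) + (a (n + 1) - a n)))
  step_x : ∀ n, (z (n + 2)).1 =
    prox (fun u => (τ : EReal) * f u) ((z (n + 1)).1 - τ • b n)

theorem IsTrajectory.mem {z : ℕ → X × Y} {a : ℕ → Y} {b : ℕ → X}
    (hz : IsTrajectory f g τ σ z a b) (hf : IsProperClosedConvex f) (hg : IsProperClosedConvex g)
    (cf : IsCompact (effDom f)) (cg : IsCompact (effDom g)) (τ_pos : 0 < τ) (σ_pos : 0 < σ) :
    ∀ n, (z n).1 ∈ effDom f ∧ (z n).2 ∈ effDom g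
  | 0 => ⟨hz.mem_f, hz.mem_g⟩
  | 1 => by rw [hz.init]; exact ⟨hz.mem_f, hz.mem_g⟩
  | n + 2 => by
    rw [hz.step_x, hz.step_y]
    exact ⟨prox_mem hf cf τ_pos _, prox_mem hg cg σ_pos _⟩

/-- The coupling term `⟪∇Φ(z) - ∇Φ(z'), w⟫` in the dual variable is controlled by the step
lengths. -/
theorem IsSmoothConvexConcave.inner_gradY_sub_le (H : IsSmoothConvexConcave f g Φ Lxx Lxy Lyx Lyy)
    {x x' : X} {y y' : Y} (hx : x ∈ effDom f) (hx' : x' ∈ effDom f) (hy : y ∈ effDom g)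
    (hy' : y' ∈ effDom g) (w : Y) :
    ⟪gradY Φ x y - gradY Φ x' y', w⟫_ℝ ≤
      Lyx / 2 * (‖x - x'‖ ^ 2 + ‖w‖ ^ 2) + Lyy / 2 * (‖y - y'‖ ^ 2 + ‖w‖ ^ 2) := by
  have h1 := real_inner_le_norm (gradY Φ x y - gradY Φ x' y') w
  have h2 := mul_le_mul_of_nonneg_right (H.lipschitz_y x hx x' hx' y hy y' hy') (norm_nonneg w)
  have h3 := mul_nonneg H.Lyx_pos.le (sq_nonneg (‖x - x'‖ - ‖w‖))
  have h4 := mul_nonneg H.Lyy_nonneg (sq_nonneg (‖y - y'‖ - ‖w‖))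
  nlinarith

/-- The potential of the Lyapunov argument, at the consecutive iterates `z'`, `z`. -/
noncomputable def potential (Φ : X → Y → ℝ) (Lyx Lyy τ σ : ℝ) (u : X) (v : Y) (z' z : X × Y) : ℝ :=
  ‖u - z.1‖ ^ 2 / (2 * τ) + ‖v - z.2‖ ^ 2 / (2 * σ)
    - ⟪gradY Φ z.1 z.2 - gradY Φ z'.1 z'.2, v - z.2⟫_ℝ
    + Lyx / 2 * ‖z.1 - z'.1‖ ^ 2 + Lyy / 2 * ‖z.2 - z'.2‖ ^ 2

/-- The cross term is paid for by the two squared step lengths and by `(Lyx + Lyy) / 2 * ‖v - z.2‖ ^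
2`, which fits under the dual distance because `σ * (Lyx + Lyy) ≤ 1`. -/
theorem potential_nonneg (H : IsSmoothConvexConcave f g Φ Lxx Lxy Lyx Lyy)
    (τ_pos : 0 < τ) (σ_pos : 0 < σ) (hσ : σ * (Lyx + 2 * Lyy) ≤ 1)
    {z z' : X × Y} (hx : z.1 ∈ effDom f) (hy : z.2 ∈ effDom g) (hx' : z'.1 ∈ effDom f)
    (hy' : z'.2 ∈ effDom g) (u : X) (v : Y) : 0 ≤ potential Φ Lyx Lyy τ σ u v z' z := by
  have h1 := H.inner_gradY_sub_le hx hx' hy hy' (v - z.2)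
  have h2 : 0 ≤ ‖u - z.1‖ ^ 2 / (2 * τ) := by positivity
  have h3 : (Lyx / 2 + Lyy / 2) * ‖v - z.2‖ ^ 2 ≤ ‖v - z.2‖ ^ 2 / (2 * σ) := by
    rw [le_div_iff₀ (by positivity)]
    have h4 : σ * (Lyx + Lyy) ≤ 1 := by nlinarith [H.Lyy_nonneg, mul_nonneg σ_pos.le H.Lyy_nonneg]
    nlinarith [sq_nonneg ‖v - z.2‖]
  unfold potential
  linarith

/-- One step of the Lyapunov argument. -/
theorem lagrangian_gap_step_le (H : IsSmoothConvexConcave f g Φ Lxx Lxy Lyx Lyy)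
    (cf : IsCompact (effDom f)) (cg : IsCompact (effDom g)) (τ_pos : 0 < τ) (σ_pos : 0 < σ)
    (hτ : τ * (Lyx + Lxx) ≤ 1) (hσ : σ * (Lyx + 2 * Lyy) ≤ 1)
    {z : ℕ → X × Y} {a : ℕ → Y} {b : ℕ → X} (hz : IsTrajectory f g τ σ z a b)
    {u : X} {v : Y} (hu : u ∈ effDom f) (hv : v ∈ effDom g) (n : ℕ) :
    realLagrangian f g Φ (z (n + 2)).1 v - realLagrangian f g Φ u (z (n + 2)).2
      ≤ -⟪b n - gradX Φ (z (n + 1)).1 (z (n + 2)).2, (z (n + 2)).1 - u⟫_ℝ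
        + ⟪(2 : ℝ) • (a (n + 1) - gradY Φ (z (n + 1)).1 (z (n + 1)).2)
            - (a n - gradY Φ (z n).1 (z n).2), (z (n + 2)).2 - v⟫_ℝ
        + potential Φ Lyx Lyy τ σ u v (z n) (z (n + 1))
        - potential Φ Lyx Lyy τ σ u v (z (n + 1)) (z (n + 2)) := by
  obtain ⟨hx0, hy0⟩ := hz.mem H.f_convex H.g_convex cf cg τ_pos σ_pos n
  obtain ⟨hx1, hy1⟩ := hz.mem H.f_convex H.g_convex cf cg τ_pos σ_pos (n + 1)
  obtain ⟨hx2, hy2⟩ := hz.mem H.f_convex H.g_convex cf cg τ_pos σ_pos (n + 2)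
  have px := prox_three_point H.f_convex cf τ_pos (z (n + 1)).1 (b n) (hz.step_x n) hu
  have py := prox_three_point H.g_convex cg σ_pos (z (n + 1)).2
    (-(a (n + 1) + (a (n + 1) - a n))) (p := (z (n + 2)).2)
    (by rw [hz.step_y n, smul_neg, sub_neg_eq_add]) hv
  have hcv := convexOn_add_fderiv_le ((H.concave_y _ hx2).neg)
    ((H.hasFDerivAt_y hx2 (z (n + 2)).2).neg) v
  have hcx := convexOn_add_fderiv_le (H.convex_x _ hy2)
    (H.hasFDerivAt_x hy2 (z (n + 1)).1) u
  have hdes := descent_lemma H.f_convex.convexOn.1 (F := fun x => Φ x (z (n + 2)).2)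
    (G := fun x => gradX Φ x (z (n + 2)).2) (L := Lxx)
    (fun x _ => H.hasFDerivAt_x hy2 x)
    (fun x hx x' hx' => by simpa using H.lipschitz_x x hx x' hx' _ hy2 _ hy2) hx1 hx2
  -- After telescoping, the momentum leaves the old gradient difference paired with the new dual
  -- step. The bound consumes the step-length terms of the old potential and part of the new dual
  -- step.
  have hq := H.inner_gradY_sub_le hx1 hx0 hy1 hy0 ((z (n + 2)).2 - (z (n + 1)).2)
  -- The proximal gain covers `Lxx / 2` from the descent lemma and `Lyx / 2` in the next potential.
  have ex : ‖(z (n + 2)).1 - (z (n + 1)).1‖ ^ 2 * (Lyx / 2 + Lxx / 2)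
      ≤ ‖(z (n + 2)).1 - (z (n + 1)).1‖ ^ 2 / (2 * τ) := by
    rw [le_div_iff₀ (by positivity)]
    nlinarith [sq_nonneg ‖(z (n + 2)).1 - (z (n + 1)).1‖]
  -- Here `(Lyx + Lyy) / 2` comes from `hq` and another `Lyy / 2` from the next potential; hence the
  -- factor `2 * Lyy` in the bound on `σ`.
  have ey : ‖(z (n + 2)).2 - (z (n + 1)).2‖ ^ 2 * (Lyx / 2 + Lyy)
      ≤ ‖(z (n + 2)).2 - (z (n + 1)).2‖ ^ 2 / (2 * σ) := by
    rw [le_div_iff₀ (by positivity)]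
    nlinarith [sq_nonneg ‖(z (n + 2)).2 - (z (n + 1)).2‖]
  simp only [sub_div] at px py
  simp only [Pi.neg_apply, neg_apply, innerSL_apply_apply] at hcv hcx
  unfold potential realLagrangian
  generalize z (n + 2) = z2 at *
  generalize z (n + 1) = z1 at *
  generalize z n = z0 at *
  generalize gradX Φ z1.1 z2.2 = gx at *
  generalize gradY Φ z0.1 z0.2 = g0 at *
  generalize gradY Φ z1.1 z1.2 = g1 at *
  generalize gradY Φ z2.1 z2.2 = g2 at *
  generalize ‖z2.1 - z1.1‖ ^ 2 / (2 * τ) = A1 at *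
  generalize ‖z2.2 - z1.2‖ ^ 2 / (2 * σ) = A2 at *
  simp only [inner_sub_left, inner_sub_right, inner_add_left, inner_smul_left, inner_neg_left,
    RCLike.conj_to_real] at px py hcv hcx hdes hq ⊢
  linarith

/-- Jensen's inequality for the gap at the ergodic average. -/
theorem lagrangian_gap_average_le (H : IsSmoothConvexConcave f g Φ Lxx Lxy Lyx Lyy)
    {N : ℕ} (hN : 0 < N) {w : ℕ → X × Y} (hw : ∀ n, (w n).1 ∈ effDom f ∧ (w n).2 ∈ effDom g)
    {u : X} {v : Y} (hu : u ∈ effDom f) (hv : v ∈ effDom g) :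
    ((1 / (N : ℝ)) • ∑ n ∈ Finset.range N, w n).1 ∈ effDom f ∧
    ((1 / (N : ℝ)) • ∑ n ∈ Finset.range N, w n).2 ∈ effDom g ∧
    realLagrangian f g Φ ((1 / (N : ℝ)) • ∑ n ∈ Finset.range N, w n).1 v
        - realLagrangian f g Φ u ((1 / (N : ℝ)) • ∑ n ∈ Finset.range N, w n).2
      ≤ (1 / (N : ℝ)) * ∑ n ∈ Finset.range N,
          (realLagrangian f g Φ (w n).1 v - realLagrangian f g Φ u (w n).2) := by
  have hN' : (0 : ℝ) < N := by exact_mod_cast hN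
  have h0 : ∀ n ∈ Finset.range N, 0 ≤ 1 / (N : ℝ) := fun _ _ => by positivity
  have h1 : ∑ n ∈ Finset.range N, 1 / (N : ℝ) = 1 := by
    simp [hN'.ne']
  have e1 : ((1 / (N : ℝ)) • ∑ n ∈ Finset.range N, w n).1
      = ∑ n ∈ Finset.range N, (1 / (N : ℝ)) • (w n).1 := by
    rw [Prod.smul_fst, Prod.fst_sum, Finset.smul_sum]
  have e2 : ((1 / (N : ℝ)) • ∑ n ∈ Finset.range N, w n).2
      = ∑ n ∈ Finset.range N, (1 / (N : ℝ)) • (w n).2 := by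
    rw [Prod.smul_snd, Prod.snd_sum, Finset.smul_sum]
  rw [e1, e2]
  have m1 := H.f_convex.convexOn.map_sum_le h0 h1 fun n _ => (hw n).1
  have m2 := H.g_convex.convexOn.map_sum_le h0 h1 fun n _ => (hw n).2
  have m3 := (H.convex_x v hv).map_sum_le (p := fun n => (w n).1) h0 h1 fun n _ => mem_univ _
  have m4 := (H.concave_y u hu).neg.map_sum_le (p := fun n => (w n).2) h0 h1
    fun n _ => mem_univ _
  refine ⟨H.f_convex.convexOn.1.sum_mem h0 h1 fun n _ => (hw n).1,
    H.g_convex.convexOn.1.sum_mem h0 h1 fun n _ => (hw n).2, ?_⟩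
  simp only [smul_eq_mul, ← Finset.mul_sum, Pi.neg_apply, Finset.sum_neg_distrib] at m1 m2 m3 m4
  have es : ∑ n ∈ Finset.range N,
      (realLagrangian f g Φ (w n).1 v - realLagrangian f g Φ u (w n).2)
      = ∑ n ∈ Finset.range N, (f (w n).1).toReal + ∑ n ∈ Finset.range N, Φ (w n).1 v
        - ∑ n ∈ Finset.range N, Φ u (w n).2 + ∑ n ∈ Finset.range N, (g (w n).2).toReal
        - N * ((f u).toReal + (g v).toReal) := by
    simp only [realLagrangian, Finset.sum_sub_distrib, Finset.sum_add_distrib, Finset.sum_const,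
      Finset.card_range, nsmul_eq_mul]
    ring
  rw [es]
  have ec : 1 / (N : ℝ) * (N * ((f u).toReal + (g v).toReal)) = (f u).toReal + (g v).toReal := by
    field_simp
  rw [mul_sub, ec]
  unfold realLagrangian
  linarith

/-- The random upper bound on `N` times the gap. -/
noncomputable def noiseBound (τ σ Ωf Ωg : ℝ) (c : X × Y) (z : ℕ → X × Y)
    (nx : ℕ → X) (ny : ℕ → Y) (N : ℕ) : ℝ :=
  ∑ n ∈ Finset.range N, (-⟪nx n, (z (n + 2)).1 - c.1⟫_ℝ
      + ⟪(2 : ℝ) • ny (n + 1) - ny n, (z (n + 2)).2 - c.2⟫_ℝ)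
    + τ / 2 * ‖∑ n ∈ Finset.range N, nx n‖ ^ 2
    + σ / 2 * ‖∑ n ∈ Finset.range N, ((2 : ℝ) • ny (n + 1) - ny n)‖ ^ 2
    + (Ωf / τ + Ωg / σ)

theorem inner_le_young {E : Type*} [NormedAddCommGroup E] [InnerProductSpace ℝ E] {c : ℝ}
    (hc : 0 < c) (p q : E) : ⟪p, q⟫_ℝ ≤ c / 2 * ‖p‖ ^ 2 + ‖q‖ ^ 2 / (2 * c) := by
  have h1 := real_inner_le_norm p q
  have h2 : ‖p‖ * ‖q‖ ≤ c / 2 * ‖p‖ ^ 2 + ‖q‖ ^ 2 / (2 * c) := by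
    have e : c / 2 * ‖p‖ ^ 2 + ‖q‖ ^ 2 / (2 * c) - ‖p‖ * ‖q‖
        = (c * ‖p‖ - ‖q‖) ^ 2 / (2 * c) := by field_simp; ring
    have : 0 ≤ (c * ‖p‖ - ‖q‖) ^ 2 / (2 * c) := by positivity
    linarith
  linarith

/-- The gap at the average along a trajectory, with the noise collected. -/
theorem lagrangian_gap_le_noiseBound (H : IsSmoothConvexConcave f g Φ Lxx Lxy Lyx Lyy)
    {Ωf Ωg : ℝ} (K : HasCompactDomains f g Ωf Ωg)
    (cf : IsCompact (effDom f)) (cg : IsCompact (effDom g)) (τ_pos : 0 < τ) (σ_pos : 0 < σ)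
    (hτ : τ * (Lyx + Lxx) ≤ 1) (hσ : σ * (Lyx + 2 * Lyy) ≤ 1)
    {z : ℕ → X × Y} {a : ℕ → Y} {b : ℕ → X} (hz : IsTrajectory f g τ σ z a b)
    {u : X} {v : Y} (hu : u ∈ effDom f) (hv : v ∈ effDom g) {N : ℕ} (hN : 0 < N) :
    realLagrangian f g Φ ((1 / (N : ℝ)) • ∑ n ∈ Finset.range N, z (n + 2)).1 v
        - realLagrangian f g Φ u ((1 / (N : ℝ)) • ∑ n ∈ Finset.range N, z (n + 2)).2
      ≤ (1 / (N : ℝ)) * noiseBound τ σ Ωf Ωg (z 0) z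
          (fun n => b n - gradX Φ (z (n + 1)).1 (z (n + 2)).2)
          (fun n => a n - gradY Φ (z n).1 (z n).2) N := by
  have hmem := hz.mem H.f_convex H.g_convex cf cg τ_pos σ_pos
  refine (lagrangian_gap_average_le H hN (fun n => hmem (n + 2)) hu hv).2.2.trans ?_
  refine mul_le_mul_of_nonneg_left ?_ (by positivity)
  have hstep := fun n => lagrangian_gap_step_le H cf cg τ_pos σ_pos hτ hσ hz hu hv n
  set nx : ℕ → X := fun n => b n - gradX Φ (z (n + 1)).1 (z (n + 2)).2
  set ny : ℕ → Y := fun n => a n - gradY Φ (z n).1 (z n).2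
  -- Each error is paired with the iterate and with the comparison point separately, both measured
  -- from `z 0`; the second pairing then involves only the summed errors.
  have hsum : ∑ n ∈ Finset.range N,
      (realLagrangian f g Φ (z (n + 2)).1 v - realLagrangian f g Φ u (z (n + 2)).2)
      ≤ ∑ n ∈ Finset.range N, (-⟪nx n, (z (n + 2)).1 - (z 0).1⟫_ℝ
          + ⟪(2 : ℝ) • ny (n + 1) - ny n, (z (n + 2)).2 - (z 0).2⟫_ℝ)
        + ⟪∑ n ∈ Finset.range N, nx n, u - (z 0).1⟫_ℝ
        + ⟪∑ n ∈ Finset.range N, ((2 : ℝ) • ny (n + 1) - ny n), (z 0).2 - v⟫_ℝ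
        + (potential Φ Lyx Lyy τ σ u v (z 0) (z 1)
          - potential Φ Lyx Lyy τ σ u v (z N) (z (N + 1))) := by
    rw [← Finset.sum_range_sub' (fun n => potential Φ Lyx Lyy τ σ u v (z n) (z (n + 1))),
      sum_inner, sum_inner, ← Finset.sum_add_distrib, ← Finset.sum_add_distrib,
      ← Finset.sum_add_distrib]
    refine Finset.sum_le_sum fun n _ => (hstep n).trans (le_of_eq ?_)
    simp only [nx, ny, inner_sub_right]
    ring
  have hpos := potential_nonneg H τ_pos σ_pos hσ (hmem (N + 1)).1 (hmem (N + 1)).2 (hmem N).1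
    (hmem N).2 u v
  have hinit : potential Φ Lyx Lyy τ σ u v (z 0) (z 1)
      = ‖u - (z 0).1‖ ^ 2 / (2 * τ) + ‖v - (z 0).2‖ ^ 2 / (2 * σ) := by
    simp [potential, hz.init]
  -- With weights `τ` and `σ`, Young's inequality costs the same distance terms as the initial
  -- potential, which doubles `Ωf / (2 * τ)` and `Ωg / (2 * σ)`.
  have y1 := inner_le_young τ_pos (∑ n ∈ Finset.range N, nx n) (u - (z 0).1)
  have y2 := inner_le_young σ_pos (∑ n ∈ Finset.range N, ((2 : ℝ) • ny (n + 1) - ny n))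
    ((z 0).2 - v)
  have d1 : ‖u - (z 0).1‖ ^ 2 / (2 * τ) ≤ Ωf / (2 * τ) :=
    div_le_div_of_nonneg_right (K.diam_f _ hu _ (hmem 0).1) (by positivity)
  have d2 : ‖v - (z 0).2‖ ^ 2 / (2 * σ) ≤ Ωg / (2 * σ) :=
    div_le_div_of_nonneg_right (K.diam_g _ hv _ (hmem 0).2) (by positivity)
  have e1 : Ωf / τ = Ωf / (2 * τ) + Ωf / (2 * τ) := by field_simp; ring
  have e2 : Ωg / σ = Ωg / (2 * σ) + Ωg / (2 * σ) := by field_simp; ring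
  rw [norm_sub_rev] at y2
  unfold noiseBound
  linarith

end Pathwise

/-! ### Noise-free surrogates of the iterates and their distance to the iterates. -/

section Hats

variable {X Y : Type*}
  [NormedAddCommGroup X] [InnerProductSpace ℝ X] [FiniteDimensional ℝ X]
  [NormedAddCommGroup Y] [InnerProductSpace ℝ Y] [FiniteDimensional ℝ Y]

/-- The primal iterate `n + 2` without the noise of its own step. -/
noncomputable def hatX (f : X → EReal) (Φ : X → Y → ℝ) (τ : ℝ) (z : ℕ → X × Y) (n : ℕ) : X :=
  prox (fun u => (τ : EReal) * f u) ((z (n + 1)).1 - τ • gradX Φ (z (n + 1)).1 (z (n + 2)).2)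

/-- The dual iterate `n + 2` without the noise of the last dual sample. -/
noncomputable def hatY (g : Y → EReal) (Φ : X → Y → ℝ) (σ : ℝ) (z : ℕ → X × Y) (a : ℕ → Y)
    (n : ℕ) : Y :=
  prox (fun v => (σ : EReal) * g v)
    ((z (n + 1)).2 + σ • ((2 : ℝ) • gradY Φ (z (n + 1)).1 (z (n + 1)).2 - a n))

/-- The iterate `n + 1` without the noise of the dual sample `n`. -/
noncomputable def hatZ (f : X → EReal) (g : Y → EReal) (Φ : X → Y → ℝ) (τ σ : ℝ)
    (z : ℕ → X × Y) (a : ℕ → Y) : ℕ → X × Y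
  | 0 => z 0
  | n + 1 => (prox (fun u => (τ : EReal) * f u)
      ((z (n + 1)).1 - τ • gradX Φ (z (n + 1)).1 (hatY g Φ σ z a n)), hatY g Φ σ z a n)

/-- The dual iterate `n + 2` without the noise of the last two dual samples. -/
noncomputable def hatY₂ (f : X → EReal) (g : Y → EReal) (Φ : X → Y → ℝ) (τ σ : ℝ)
    (z : ℕ → X × Y) (a : ℕ → Y) (n : ℕ) : Y :=
  prox (fun v => (σ : EReal) * g v)
    ((hatZ f g Φ τ σ z a n).2 + σ • ((2 : ℝ) • gradY Φ (hatZ f g Φ τ σ z a n).1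
      (hatZ f g Φ τ σ z a n).2 - gradY Φ (z n).1 (z n).2))

/-- The primal noise used in the computation of the iterate `n + 1`. -/
def prevNoise (nx : ℕ → X) : ℕ → X
  -- Iterate `1` is a copy of iterate `0`, so no primal noise enters it.
  | 0 => 0
  | n + 1 => nx n

variable {f : X → EReal} {g : Y → EReal} {Φ : X → Y → ℝ} {Lxx Lxy Lyx Lyy : ℝ} {τ σ : ℝ}
  {z : ℕ → X × Y} {a : ℕ → Y} {b : ℕ → X}

theorem IsTrajectory.step_y' (hz : IsTrajectory f g τ σ z a b) (n : ℕ) :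
    (z (n + 2)).2 =
      prox (fun v => (σ : EReal) * g v) ((z (n + 1)).2 + σ • ((2 : ℝ) • a (n + 1) - a n)) := by
  rw [hz.step_y n, two_smul, add_sub_assoc]

theorem norm_sub_hatX_le (H : IsSmoothConvexConcave f g Φ Lxx Lxy Lyx Lyy)
    (cf : IsCompact (effDom f)) (τ_pos : 0 < τ) (hz : IsTrajectory f g τ σ z a b) (n : ℕ) :
    ‖(z (n + 2)).1 - hatX f Φ τ z n‖ ≤ τ * ‖b n - gradX Φ (z (n + 1)).1 (z (n + 2)).2‖ := by
  rw [hz.step_x n, hatX]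
  refine (norm_prox_sub_prox_le H.f_convex cf τ_pos _ _).trans (le_of_eq ?_)
  rw [sub_sub_sub_cancel_left, ← smul_sub, norm_smul, Real.norm_of_nonneg τ_pos.le, norm_sub_rev]

theorem norm_sub_hatY_le (H : IsSmoothConvexConcave f g Φ Lxx Lxy Lyx Lyy)
    (cg : IsCompact (effDom g)) (σ_pos : 0 < σ) (hz : IsTrajectory f g τ σ z a b) (n : ℕ) :
    ‖(z (n + 2)).2 - hatY g Φ σ z a n‖
      ≤ 2 * σ * ‖a (n + 1) - gradY Φ (z (n + 1)).1 (z (n + 1)).2‖ := by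
  rw [hz.step_y' n, hatY]
  refine (norm_prox_sub_prox_le H.g_convex cg σ_pos _ _).trans (le_of_eq ?_)
  rw [add_sub_add_left_eq_sub, ← smul_sub, sub_sub_sub_cancel_right, ← smul_sub, norm_smul,
    norm_smul, Real.norm_of_nonneg σ_pos.le, Real.norm_of_nonneg zero_le_two]
  ring

theorem hatZ_mem (H : IsSmoothConvexConcave f g Φ Lxx Lxy Lyx Lyy)
    (cf : IsCompact (effDom f)) (cg : IsCompact (effDom g)) (τ_pos : 0 < τ) (σ_pos : 0 < σ)
    (hz : IsTrajectory f g τ σ z a b) (n : ℕ) :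
    (hatZ f g Φ τ σ z a n).1 ∈ effDom f ∧ (hatZ f g Φ τ σ z a n).2 ∈ effDom g := by
  cases n with
  | zero => exact ⟨hz.mem_f, hz.mem_g⟩
  | succ n => exact ⟨prox_mem H.f_convex cf τ_pos _, prox_mem H.g_convex cg σ_pos _⟩

theorem norm_sub_hatZ_snd_le (H : IsSmoothConvexConcave f g Φ Lxx Lxy Lyx Lyy)
    (cg : IsCompact (effDom g)) (σ_pos : 0 < σ) (hz : IsTrajectory f g τ σ z a b) (n : ℕ) :
    ‖(z (n + 1)).2 - (hatZ f g Φ τ σ z a n).2‖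
      ≤ 2 * σ * ‖a n - gradY Φ (z n).1 (z n).2‖ := by
  cases n with
  | zero =>
    simp only [hatZ, zero_add, hz.init, sub_self, norm_zero]
    positivity
  | succ n => exact norm_sub_hatY_le H cg σ_pos hz n

/-- The primal oracle need not be Lipschitz in `y`, so moving the dual argument to `hatY` forces a
passage to the exact gradient. This brings in the primal noise of the preceding step beside the
Lipschitz term with `Lxy`. -/
theorem norm_sub_hatZ_fst_le (H : IsSmoothConvexConcave f g Φ Lxx Lxy Lyx Lyy)
    (cf : IsCompact (effDom f)) (cg : IsCompact (effDom g)) (τ_pos : 0 < τ) (σ_pos : 0 < σ)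
    (hz : IsTrajectory f g τ σ z a b) (n : ℕ) :
    ‖(z (n + 1)).1 - (hatZ f g Φ τ σ z a n).1‖
      ≤ τ * (‖prevNoise (fun n => b n - gradX Φ (z (n + 1)).1 (z (n + 2)).2) n‖
        + Lxy * (2 * σ * ‖a n - gradY Φ (z n).1 (z n).2‖)) := by
  have hL := H.Lxy_pos.le
  cases n with
  | zero =>
    simp only [hatZ, zero_add, hz.init, sub_self, norm_zero]
    positivity
  | succ n =>
    have hmem := hz.mem H.f_convex H.g_convex cf cg τ_pos σ_pos
    have h1 := norm_sub_hatY_le H cg σ_pos hz n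
    have h2 := H.lipschitz_x _ (hmem (n + 1)).1 _ (hmem (n + 1)).1 _ (hmem (n + 2)).2
      _ (hatZ_mem H cf cg τ_pos σ_pos hz (n + 1)).2
    simp only [sub_self, norm_zero, mul_zero, zero_add] at h2
    simp only [hatZ, prevNoise] at h2 ⊢
    rw [hz.step_x n]
    refine (norm_prox_sub_prox_le H.f_convex cf τ_pos _ _).trans ?_
    rw [sub_sub_sub_cancel_left, ← smul_sub, norm_smul, Real.norm_of_nonneg τ_pos.le, norm_sub_rev]
    refine mul_le_mul_of_nonneg_left ?_ τ_pos.le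
    have h3 := norm_add_le (b n - gradX Φ (z (n + 1)).1 (z (n + 2)).2)
      (gradX Φ (z (n + 1)).1 (z (n + 2)).2 - gradX Φ (z (n + 1)).1 (hatY g Φ σ z a n))
    rw [sub_add_sub_cancel] at h3
    have h4 := mul_le_mul_of_nonneg_left h1 hL
    linarith

/-- The dual error `n` reaches iterate `n + 2` directly through the momentum and indirectly through
both coordinates of iterate `n + 1`. Nonexpansiveness and the step-size bounds keep every route of
order `σ` or `τ`. -/
theorem norm_mul_norm_sub_hatY₂_le (H : IsSmoothConvexConcave f g Φ Lxx Lxy Lyx Lyy)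
    (cf : IsCompact (effDom f)) (cg : IsCompact (effDom g)) (τ_pos : 0 < τ) (σ_pos : 0 < σ)
    (hτ : τ * (Lyx + Lxx) ≤ 1) (hσ : σ * (Lyx + 2 * Lyy) ≤ 1) (hσ' : σ * Lxy ≤ 1)
    (hz : IsTrajectory f g τ σ z a b) (n : ℕ) :
    ‖a n - gradY Φ (z n).1 (z n).2‖ * ‖(z (n + 2)).2 - hatY₂ f g Φ τ σ z a n‖
      ≤ 11 * σ * ‖a n - gradY Φ (z n).1 (z n).2‖ ^ 2
        + σ * ‖a (n + 1) - gradY Φ (z (n + 1)).1 (z (n + 1)).2‖ ^ 2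
        + τ * ‖prevNoise (fun n => b n - gradX Φ (z (n + 1)).1 (z (n + 2)).2) n‖ ^ 2 := by
  have hmem := hz.mem H.f_convex H.g_convex cf cg τ_pos σ_pos
  have hm := hatZ_mem H cf cg τ_pos σ_pos hz n
  have h1 := norm_sub_hatZ_snd_le H cg σ_pos hz n
  have h2 := norm_sub_hatZ_fst_le H cf cg τ_pos σ_pos hz n
  have h3 := H.lipschitz_y _ (hmem (n + 1)).1 _ hm.1 _ (hmem (n + 1)).2 _ hm.2
  have h4 : ‖(z (n + 2)).2 - hatY₂ f g Φ τ σ z a n‖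
      ≤ ‖(z (n + 1)).2 - (hatZ f g Φ τ σ z a n).2‖
        + σ * (2 * ‖gradY Φ (z (n + 1)).1 (z (n + 1)).2
            - gradY Φ (hatZ f g Φ τ σ z a n).1 (hatZ f g Φ τ σ z a n).2‖
          + 2 * ‖a (n + 1) - gradY Φ (z (n + 1)).1 (z (n + 1)).2‖
          + ‖a n - gradY Φ (z n).1 (z n).2‖) := by
    rw [hz.step_y' n, hatY₂]
    refine (norm_prox_sub_prox_le H.g_convex cg σ_pos _ _).trans ?_
    generalize hatZ f g Φ τ σ z a n = w
    generalize gradY Φ (z (n + 1)).1 (z (n + 1)).2 = g1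
    generalize gradY Φ (z n).1 (z n).2 = g0
    generalize gradY Φ w.1 w.2 = gw
    have e : (z (n + 1)).2 + σ • ((2 : ℝ) • a (n + 1) - a n) - (w.2 + σ • ((2 : ℝ) • gw - g0))
        = ((z (n + 1)).2 - w.2)
          + σ • ((2 : ℝ) • (g1 - gw) + (2 : ℝ) • (a (n + 1) - g1) - (a n - g0)) := by module
    rw [e]
    refine (norm_add_le _ _).trans (add_le_add le_rfl ?_)
    rw [norm_smul, Real.norm_of_nonneg σ_pos.le]
    refine mul_le_mul_of_nonneg_left ?_ σ_pos.le
    refine (norm_sub_le _ _).trans (add_le_add ((norm_add_le _ _).trans ?_) le_rfl)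
    rw [norm_smul, norm_smul, Real.norm_of_nonneg zero_le_two]
  have hLyx := H.Lyx_pos
  have hLyy := H.Lyy_nonneg
  have hLxx := H.Lxx_nonneg
  have hLxy := H.Lxy_pos
  generalize ‖(z (n + 2)).2 - hatY₂ f g Φ τ σ z a n‖ = d at *
  generalize ‖(z (n + 1)).2 - (hatZ f g Φ τ σ z a n).2‖ = dy at *
  generalize ‖(z (n + 1)).1 - (hatZ f g Φ τ σ z a n).1‖ = dx at *
  generalize ‖gradY Φ (z (n + 1)).1 (z (n + 1)).2
            - gradY Φ (hatZ f g Φ τ σ z a n).1 (hatZ f g Φ τ σ z a n).2‖ = dg at *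
  have hp0 := norm_nonneg (a n - gradY Φ (z n).1 (z n).2)
  have hr0 := norm_nonneg (a (n + 1) - gradY Φ (z (n + 1)).1 (z (n + 1)).2)
  have hq0 := norm_nonneg (prevNoise (fun n => b n - gradX Φ (z (n + 1)).1 (z (n + 2)).2) n)
  generalize ‖a n - gradY Φ (z n).1 (z n).2‖ = p at *
  generalize ‖a (n + 1) - gradY Φ (z (n + 1)).1 (z (n + 1)).2‖ = r at *
  generalize ‖prevNoise (fun n => b n - gradX Φ (z (n + 1)).1 (z (n + 2)).2) n‖ = q at *
  have c1 : τ * Lyx ≤ 1 := by nlinarith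
  have c2 : σ * Lyx ≤ 1 := by nlinarith
  have c3 : σ * (2 * Lyy) ≤ 1 := by nlinarith
  have e1 : σ * (2 * (Lyx * dx)) ≤ 2 * (σ * τ * Lyx * q) + 4 * σ * p := by
    have s1 : Lyx * dx ≤ Lyx * (τ * (q + Lxy * (2 * σ * p))) :=
      mul_le_mul_of_nonneg_left h2 hLyx.le
    have s2 : (τ * Lyx) * (σ * Lxy) ≤ 1 := mul_le_one₀ c1 (by positivity) hσ'
    have s3 := mul_le_mul_of_nonneg_left s2 (by positivity : 0 ≤ 4 * σ * p)
    have s4 := mul_le_mul_of_nonneg_left s1 (by positivity : 0 ≤ 2 * σ)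
    linarith
  have e2 : σ * (2 * (Lyy * dy)) ≤ 2 * σ * p := by
    have s1 : (σ * (2 * Lyy)) * dy ≤ (σ * (2 * Lyy)) * (2 * σ * p) :=
      mul_le_mul_of_nonneg_left h1 (by positivity)
    have s2 := mul_le_mul_of_nonneg_right c3 (by positivity : 0 ≤ 2 * σ * p)
    linarith
  -- Here `9 = 2 + 4 + 2 + 1`: the shift of the proximal centre, the `x`- and `y`-parts of the
  -- gradient difference, and the momentum. Multiplying by `p`, the two mixed products add one `σ *
  -- p ^ 2` each, giving `11`.
  have e3 : d ≤ 9 * σ * p + 2 * σ * r + 2 * (σ * τ * Lyx * q) := by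
    have := mul_le_mul_of_nonneg_left h3 (by positivity : 0 ≤ σ * 2)
    linarith
  have e4 := mul_le_mul_of_nonneg_left e3 hp0
  have e5 : 2 * (σ * p * r) ≤ σ * p ^ 2 + σ * r ^ 2 := by
    nlinarith [mul_nonneg σ_pos.le (sq_nonneg (p - r))]
  have e6 : 2 * (σ * τ * Lyx * p * q) ≤ σ * p ^ 2 + τ * q ^ 2 := by
    have s1 := mul_nonneg hLyx.le (sq_nonneg (σ * p - τ * q))
    have s2 := mul_le_mul_of_nonneg_right c2 (by positivity : 0 ≤ σ * p ^ 2)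
    have s3 := mul_le_mul_of_nonneg_right c1 (by positivity : 0 ≤ τ * q ^ 2)
    nlinarith
  nlinarith

/-- The noise terms of one step are bounded by terms of mean zero and squared noises. -/
theorem noise_step_le (H : IsSmoothConvexConcave f g Φ Lxx Lxy Lyx Lyy)
    (cf : IsCompact (effDom f)) (cg : IsCompact (effDom g)) (τ_pos : 0 < τ) (σ_pos : 0 < σ)
    (hτ : τ * (Lyx + Lxx) ≤ 1) (hσ : σ * (Lyx + 2 * Lyy) ≤ 1) (hσ' : σ * Lxy ≤ 1)
    (hz : IsTrajectory f g τ σ z a b) {nx : ℕ → X} {ny : ℕ → Y}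
    (hnx : nx = fun n => b n - gradX Φ (z (n + 1)).1 (z (n + 2)).2)
    (hny : ny = fun n => a n - gradY Φ (z n).1 (z n).2) (c : X × Y) (n : ℕ) :
    -⟪nx n, (z (n + 2)).1 - c.1⟫_ℝ + ⟪(2 : ℝ) • ny (n + 1) - ny n, (z (n + 2)).2 - c.2⟫_ℝ
      ≤ (-⟪nx n, hatX f Φ τ z n - c.1⟫_ℝ + 2 * ⟪ny (n + 1), hatY g Φ σ z a n - c.2⟫_ℝ
          - ⟪ny n, hatY₂ f g Φ τ σ z a n - c.2⟫_ℝ)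
        + (τ * ‖nx n‖ ^ 2 + τ * ‖prevNoise nx n‖ ^ 2 + 5 * σ * ‖ny (n + 1)‖ ^ 2
          + 11 * σ * ‖ny n‖ ^ 2) := by
  have h1 := norm_sub_hatX_le H cf τ_pos hz n
  have h2 := norm_sub_hatY_le H cg σ_pos hz n
  have h3 := norm_mul_norm_sub_hatY₂_le H cf cg τ_pos σ_pos hτ hσ hσ' hz n
  rw [← hnx] at h3
  have i1 := abs_real_inner_le_norm (nx n) ((z (n + 2)).1 - hatX f Φ τ z n)
  have i2 := real_inner_le_norm (ny (n + 1)) ((z (n + 2)).2 - hatY g Φ σ z a n)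
  have i3 := abs_real_inner_le_norm (ny n) ((z (n + 2)).2 - hatY₂ f g Φ τ σ z a n)
  have j1 := neg_le_of_abs_le i1
  have j3 := neg_le_of_abs_le i3
  have ex : b n - gradX Φ (z (n + 1)).1 (z (n + 2)).2 = nx n := by rw [hnx]
  have ey : ∀ n, a n - gradY Φ (z n).1 (z n).2 = ny n := fun n => by rw [hny]
  rw [ex] at h1
  simp only [ey] at h2 h3
  have k1 := mul_le_mul_of_nonneg_left h1 (norm_nonneg (nx n))
  have k2 := mul_le_mul_of_nonneg_left h2 (norm_nonneg (ny (n + 1)))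
  -- The coefficient `5 * σ` is `2 * (2 * σ)` from `k2` plus the `σ` in `h3`.
  simp only [inner_sub_left, inner_sub_right, inner_smul_left, RCLike.conj_to_real] at j1 i2 j3 ⊢
  nlinarith

end Hats

/-! ### Fresh samples, conditional expectations and orthogonal errors. -/

section Independence

variable {S : Type*} {F mS : MeasurableSpace S} {P : Measure S} [IsProbabilityMeasure P]

/-- The joint law of the three variables is a triple product measure, and regrouping the factors
preserves it. -/
theorem indepFun_prodMk_of_indepFun {α β γ : Type*} [MeasurableSpace α] [MeasurableSpace β]
    [MeasurableSpace γ] {A : S → α} {B : S → β} {C : S → γ} (hA : Measurable A)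
    (hB : Measurable B) (hC : Measurable C) (h1 : IndepFun A (fun s => (B s, C s)) P)
    (h2 : IndepFun B C P) : IndepFun (fun s => (A s, B s)) C P := by
  have hAB : IndepFun A B P := h1.comp measurable_id measurable_fst
  rw [indepFun_iff_map_prod_eq_prod_map_map (hA.prodMk hB).aemeasurable hC.aemeasurable,
    (indepFun_iff_map_prod_eq_prod_map_map hA.aemeasurable hB.aemeasurable).1 hAB]
  have e1 := (indepFun_iff_map_prod_eq_prod_map_map hA.aemeasurable
    (hB.prodMk hC).aemeasurable).1 h1
  rw [(indepFun_iff_map_prod_eq_prod_map_map hB.aemeasurable hC.aemeasurable).1 h2] at e1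
  have : IsProbabilityMeasure (P.map A) := Measure.isProbabilityMeasure_map hA.aemeasurable
  have : IsProbabilityMeasure (P.map B) := Measure.isProbabilityMeasure_map hB.aemeasurable
  have : IsProbabilityMeasure (P.map C) := Measure.isProbabilityMeasure_map hC.aemeasurable
  have e2 := congrArg (Measure.map (MeasurableEquiv.prodAssoc (α := α) (β := β) (γ := γ)).symm) e1
  rw [Measure.map_map (MeasurableEquiv.measurable _) (hA.prodMk (hB.prodMk hC)),
    ← (measurePreserving_prodAssoc (P.map A) (P.map B) (P.map C)).map_eq,
    Measure.map_map (MeasurableEquiv.measurable _) (MeasurableEquiv.measurable _)] at e2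
  simp only [Function.comp_def, MeasurableEquiv.symm_apply_apply, Measure.map_id'] at e2
  exact e2

/-- A sample of an independent sequence is independent of the preceding samples together with an
independent source of randomness. -/
theorem indepFun_past {α β : Type*} [MeasurableSpace α] [MeasurableSpace β]
    {A : S → α} {ω : ℕ → S → β} (hA : Measurable A) (hω : ∀ n, Measurable (ω n))
    (h1 : IndepFun A (fun s n => ω n s) P) (h2 : iIndepFun ω P) (n : ℕ) :
    IndepFun (fun s => (A s, fun j : Finset.range n => ω j s)) (ω n) P := by
  refine indepFun_prodMk_of_indepFun hA (measurable_pi_lambda _ fun j => hω j) (hω n) ?_ ?_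
  · exact h1.comp (φ := id) (ψ := fun w : ℕ → β => (fun j : Finset.range n => w j, w n))
      measurable_id (by fun_prop)
  · have := h2.indepFun_finset (Finset.range n) {n} (by simp) hω
    exact this.comp (φ := id) (ψ := fun w : ({n} : Finset ℕ) → β => w ⟨n, by simp⟩)
      measurable_id (by fun_prop)

variable {Z W E : Type*} [MeasurableSpace Z] [MeasurableSpace W] [NormedAddCommGroup E]
  [InnerProductSpace ℝ E] [FiniteDimensional ℝ E] [MeasurableSpace E] [BorelSpace E]

/-- Conditional expectation of a function of a known variable and an independent one. -/
theorem condExp_comp_indep (hF : F ≤ mS) {w : S → W} (hw : Measurable w)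
    (hi : Indep F (MeasurableSpace.comap w inferInstance) P) {u : S → Z} (hu : Measurable[F] u)
    {G : Z × W → E} (hG : Measurable G) (hint : Integrable (fun s => G (u s, w s)) P) :
    P[fun s => G (u s, w s) | F] =ᵐ[P] fun s => ∫ t, G (u s, t) ∂(P.map w) := by
  have : CompleteSpace E := FiniteDimensional.complete ℝ E
  have : IsProbabilityMeasure (P.map w) := Measure.isProbabilityMeasure_map hw.aemeasurable
  have hGs : StronglyMeasurable G := hG.stronglyMeasurable
  have hh : StronglyMeasurable (fun p : Z => ∫ t, G (p, t) ∂(P.map w)) :=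
    StronglyMeasurable.integral_prod_right (f := fun p t => G (p, t)) hGs
  have hlaw : ∀ {A : Type _} [MeasurableSpace A] {v : S → A}, Measurable[F] v →
      P.map (fun s => (v s, w s)) = (P.map v).prod (P.map w) := by
    intro A _ v hv
    refine (indepFun_iff_map_prod_eq_prod_map_map (hv.mono hF le_rfl).aemeasurable
      hw.aemeasurable).1 ?_
    exact (IndepFun_iff_Indep _ _ _).2 (indep_of_indep_of_le_left hi hv.comap_le)
  have hu' := hu.mono hF le_rfl
  have hGint : Integrable G ((P.map u).prod (P.map w)) := by
    rw [← hlaw hu]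
    exact (integrable_map_measure hGs.aestronglyMeasurable (hu'.prodMk hw).aemeasurable).2 hint
  have hhint : Integrable (fun s => ∫ t, G (u s, t) ∂(P.map w)) P :=
    (integrable_map_measure hh.aestronglyMeasurable hu'.aemeasurable).1 hGint.integral_prod_left
  refine (ae_eq_condExp_of_forall_setIntegral_eq hF hint (fun _ _ _ => hhint.integrableOn) ?_
    ((hh.measurable.comp hu).stronglyMeasurable.aestronglyMeasurable)).symm
  intro A hA _
  -- Adjoining the indicator of the test set to `u` keeps the pair independent of `w`, so Fubini
  -- computes the integral over `A`.
  have hr : Measurable[F] (A.indicator (fun _ => (1 : ℝ))) := measurable_const.indicator hA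
  have hv : Measurable[F] (fun s => (u s, A.indicator (fun _ => (1 : ℝ)) s)) := hu.prodMk hr
  have hv' := hv.mono hF le_rfl
  have hind : ∀ φ : S → E, ∫ s in A, φ s ∂P
      = ∫ s, A.indicator (fun _ => (1 : ℝ)) s • φ s ∂P := by
    intro φ
    rw [← integral_indicator (hF A hA)]
    refine integral_congr_ae (ae_of_all _ fun s => ?_)
    by_cases hs : s ∈ A <;> simp [hs]
  have hKs : StronglyMeasurable (fun q : (Z × ℝ) × W => q.1.2 • G (q.1.1, q.2)) :=
    (by fun_prop : Measurable fun q : (Z × ℝ) × W => q.1.2 • G (q.1.1, q.2)).stronglyMeasurable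
  have hKint : Integrable (fun q : (Z × ℝ) × W => q.1.2 • G (q.1.1, q.2))
      ((P.map (fun s => (u s, A.indicator (fun _ => (1 : ℝ)) s))).prod (P.map w)) := by
    rw [← hlaw hv]
    refine (integrable_map_measure hKs.aestronglyMeasurable (hv'.prodMk hw).aemeasurable).2 ?_
    refine (hint.indicator (hF A hA)).congr (ae_of_all _ fun s => ?_)
    by_cases hs : s ∈ A <;> simp [hs]
  rw [hind, hind]
  have e1 : ∫ s, A.indicator (fun _ => (1 : ℝ)) s • G (u s, w s) ∂P
      = ∫ q, q.1.2 • G (q.1.1, q.2)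
        ∂(P.map (fun s => ((u s, A.indicator (fun _ => (1 : ℝ)) s), w s))) :=
    (integral_map (hv'.prodMk hw).aemeasurable hKs.aestronglyMeasurable).symm
  rw [e1, hlaw hv, integral_prod _ hKint]
  simp only [integral_smul]
  rw [integral_map hv'.aemeasurable]
  refine Measurable.aestronglyMeasurable ?_
  exact measurable_snd.smul (hh.measurable.comp measurable_fst)

/-- The error of an unbiased oracle queried at a past point with a fresh sample is orthogonal to
every past variable. -/
theorem integral_inner_oracle_error (hF : F ≤ mS) {w : S → W}
    (hw : Measurable w) (hi : Indep F (MeasurableSpace.comap w inferInstance) P) {u : S → Z}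
    (hu : Measurable[F] u) {G : Z × W → E} (hG : Measurable G)
    (hint : Integrable (fun s => G (u s, w s)) P) {D : S → E}
    (hD : P[fun s => G (u s, w s) | MeasurableSpace.comap u inferInstance] =ᵐ[P] D)
    {V : S → E} (hV : Measurable[F] V)
    (hVint : Integrable (fun s => ⟪G (u s, w s) - D s, V s⟫_ℝ) P) :
    ∫ s, ⟪G (u s, w s) - D s, V s⟫_ℝ ∂P = 0 := by
  have : CompleteSpace E := FiniteDimensional.complete ℝ E
  have hle : MeasurableSpace.comap u inferInstance ≤ F := hu.comap_le
  -- Unbiasedness is given only conditionally on the query point. By independence, conditioning on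
  -- `u` and on all of `F` gives the same average over the sample, so the oracle is unbiased given
  -- `F`.
  have h1 := condExp_comp_indep (hle.trans hF) hw (indep_of_indep_of_le_left hi hle)
    (comap_measurable u) hG hint
  have h2 := condExp_comp_indep hF hw hi hu hG hint
  have hDF : D =ᵐ[P] P[fun s => G (u s, w s) | F] := (hD.symm.trans h1).trans h2.symm
  have hDint : Integrable D P := integrable_condExp.congr hD
  have hcond : P[fun s => G (u s, w s) - D s | F] =ᵐ[P] 0 := by
    have h3 : P[D | F] =ᵐ[P] P[fun s => G (u s, w s) | F] := by
      refine (condExp_congr_ae hDF).trans ?_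
      rw [condExp_of_stronglyMeasurable hF stronglyMeasurable_condExp integrable_condExp]
    filter_upwards [condExp_sub hint hDint F, h3] with s h4 h5
    have : P[fun s => G (u s, w s) - D s | F] s = (P[fun s => G (u s, w s) | F] - P[D | F]) s := h4
    rw [this, Pi.sub_apply, h5, sub_self, Pi.zero_apply]
  have hpull := condExp_bilin_of_stronglyMeasurable_right (m := F) (innerSL ℝ (E := E))
    (hV.stronglyMeasurable) hVint (hint.sub hDint)
  rw [← integral_condExp hF]
  refine integral_eq_zero_of_ae ?_
  filter_upwards [hpull, hcond] with s h6 h7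
  have h8 : P[fun s => ⟪G (u s, w s) - D s, V s⟫_ℝ | F] s
    = innerSL ℝ (P[fun s => G (u s, w s) - D s | F] s) (V s) := h6
  rw [h8, h7]
  simp

theorem integrable_inner_of_memLp {p q : S → E} (hp : MemLp p 2 P) (hq : MemLp q 2 P) :
    Integrable (fun s => ⟪p s, q s⟫_ℝ) P :=
  (hp.norm.integrable_mul hq.norm).mono (hp.1.inner hq.1) (ae_of_all _ fun s => by
    simpa [abs_mul] using abs_real_inner_le_norm (p s) (q s))

/-- Orthogonal increments: the squared norm of a sum of `L²` errors has mean at most the sum of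
the variances. -/
theorem integral_norm_sum_sq_le {n : ℕ → S → E} {δ : ℝ} (hm : ∀ k, AEStronglyMeasurable (n k) P)
    (hsq : ∀ k, Integrable (fun s => ‖n k s‖ ^ 2) P) (hδ : ∀ k, ∫ s, ‖n k s‖ ^ 2 ∂P ≤ δ ^ 2)
    (horth : ∀ k, ∫ s, ⟪n k s, ∑ j ∈ Finset.range k, n j s⟫_ℝ ∂P = 0) (N : ℕ) :
    Integrable (fun s => ‖∑ k ∈ Finset.range N, n k s‖ ^ 2) P ∧
    ∫ s, ‖∑ k ∈ Finset.range N, n k s‖ ^ 2 ∂P ≤ N * δ ^ 2 := by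
  have hL : ∀ k, MemLp (n k) 2 P := fun k => (memLp_two_iff_integrable_sq_norm (hm k)).2 (hsq k)
  have hS : ∀ N, MemLp (fun s => ∑ k ∈ Finset.range N, n k s) 2 P := fun N =>
    memLp_finsetSum _ fun k _ => hL k
  have hI : ∀ N, Integrable (fun s => ‖∑ k ∈ Finset.range N, n k s‖ ^ 2) P := fun N =>
    (memLp_two_iff_integrable_sq_norm (hS N).1).1 (hS N)
  refine ⟨hI N, ?_⟩
  induction N with
  | zero => simp
  | succ N ih =>
    have hin : Integrable (fun s => ⟪n N s, ∑ j ∈ Finset.range N, n j s⟫_ℝ) P :=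
      integrable_inner_of_memLp (hL N) (hS N)
    have e : ∀ s, ‖∑ k ∈ Finset.range (N + 1), n k s‖ ^ 2
        = ‖∑ k ∈ Finset.range N, n k s‖ ^ 2
          + 2 * ⟪n N s, ∑ j ∈ Finset.range N, n j s⟫_ℝ + ‖n N s‖ ^ 2 := by
      intro s
      rw [Finset.sum_range_succ, norm_add_sq_real, real_inner_comm]
    simp only [e]
    rw [integral_add (by exact (hI N).add (hin.const_mul 2)) (hsq N),
      integral_add (hI N) (hin.const_mul 2),
      integral_const_mul, horth N]
    push_cast
    linarith [hδ N]

theorem integral_le_of_condExp_le (hF : F ≤ mS) {φ : S → ℝ} {c : ℝ}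
    (h : P[φ | F] ≤ᵐ[P] fun _ => c) : ∫ s, φ s ∂P ≤ c := by
  rw [← integral_condExp hF]
  refine (integral_mono_ae integrable_condExp (integrable_const c) h).trans ?_
  simp

end Independence

/-! ### Measurability of gradients and iterates. -/

section Measurability

variable {X Y Wx Wy S : Type*}
  [NormedAddCommGroup X] [InnerProductSpace ℝ X] [FiniteDimensional ℝ X]
  [MeasurableSpace X] [BorelSpace X]
  [NormedAddCommGroup Y] [InnerProductSpace ℝ Y] [FiniteDimensional ℝ Y]
  [MeasurableSpace Y] [BorelSpace Y]
  [MeasurableSpace Wx] [MeasurableSpace Wy]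
  {f : X → EReal} {g : Y → EReal} {Φ : X → Y → ℝ} {Lxx Lxy Lyx Lyy : ℝ} {τ σ : ℝ}

theorem continuousOn_of_norm_sub_le {E : Type*} [NormedAddCommGroup E] {A : Set (X × Y)}
    {G : X × Y → E} {K L : ℝ} (hK : 0 ≤ K) (hL : 0 ≤ L)
    (h : ∀ p ∈ A, ∀ q ∈ A, ‖G p - G q‖ ≤ K * ‖p.1 - q.1‖ + L * ‖p.2 - q.2‖) :
    ContinuousOn G A := by
  refine (LipschitzOnWith.of_dist_le_mul (K := (K + L).toNNReal) fun p hp q hq => ?_).continuousOn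
  rw [dist_eq_norm, dist_eq_norm, Real.coe_toNNReal _ (by positivity)]
  have h1 := mul_le_mul_of_nonneg_left (norm_fst_le (p - q)) hK
  have h2 := mul_le_mul_of_nonneg_left (norm_snd_le (p - q)) hL
  have h3 := h p hp q hq
  simp only [Prod.fst_sub, Prod.snd_sub] at h1 h2
  linarith

/-- The partial gradients are controlled only on the domains; factoring through the subtype makes
regularity elsewhere irrelevant. -/
theorem measurable_comp_of_continuousOn {mS : MeasurableSpace S} {E : Type*} [TopologicalSpace E]
    [MeasurableSpace E] [BorelSpace E] {A : Set (X × Y)} {G : X × Y → E} (hG : ContinuousOn G A)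
    {p : S → X × Y} (hp : Measurable p) (hmem : ∀ s, p s ∈ A) : Measurable fun s => G (p s) :=
  (continuousOn_iff_continuous_domRestrict.1 hG).measurable.comp (hp.subtype_mk (h := hmem))

theorem IsSmoothConvexConcave.measurable_gradX {mS : MeasurableSpace S}
    (H : IsSmoothConvexConcave f g Φ Lxx Lxy Lyx Lyy) {p : S → X × Y} (hp : Measurable p)
    (hmem : ∀ s, (p s).1 ∈ effDom f ∧ (p s).2 ∈ effDom g) :
    Measurable fun s => gradX Φ (p s).1 (p s).2 :=
  measurable_comp_of_continuousOn (A := effDom f ×ˢ effDom g) (G := fun p => gradX Φ p.1 p.2)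
    (continuousOn_of_norm_sub_le H.Lxx_nonneg H.Lxy_pos.le fun _ hp _ hq =>
      H.lipschitz_x _ hp.1 _ hq.1 _ hp.2 _ hq.2) hp hmem

theorem IsSmoothConvexConcave.measurable_gradY {mS : MeasurableSpace S}
    (H : IsSmoothConvexConcave f g Φ Lxx Lxy Lyx Lyy) {p : S → X × Y} (hp : Measurable p)
    (hmem : ∀ s, (p s).1 ∈ effDom f ∧ (p s).2 ∈ effDom g) :
    Measurable fun s => gradY Φ (p s).1 (p s).2 :=
  measurable_comp_of_continuousOn (A := effDom f ×ˢ effDom g) (G := fun p => gradY Φ p.1 p.2)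
    (continuousOn_of_norm_sub_le H.Lyx_pos.le H.Lyy_nonneg fun _ hp _ hq =>
      H.lipschitz_y _ hp.1 _ hq.1 _ hp.2 _ hq.2) hp hmem

variable {Gx : X → Y → Wx → X} {Gy : X → Y → Wy → Y} {x₀ : X} {y₀ : Y}
  {ωx : ℕ → S → Wx} {ωy : ℕ → S → Wy}

theorem isTrajectory_process (hx : x₀ ∈ effDom f) (hy : y₀ ∈ effDom g) {z : ℕ → S → X × Y}
    (hz : z = process f g Gx Gy τ σ 1 x₀ y₀ ωx ωy) (s : S) :
    IsTrajectory f g τ σ (fun n => z n s)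
      (fun n => Gy (z n s).1 (z n s).2 (ωy n s))
      (fun n => Gx (z (n + 1) s).1 (z (n + 2) s).2 (ωx n s)) := by
  subst hz
  refine ⟨rfl, hx, hy, fun n => ?_, fun n => ?_⟩
  · simp [process, iterate, step]
  · simp [process, iterate, step]

/-- The σ-algebra is arbitrary, so this records which samples each iterate depends on. The dual
coordinate is updated first: that of `z (n + 1)` uses one more dual sample than `z n`, but no
further primal one. -/
theorem measurable_trajectory {mS : MeasurableSpace S} {z : ℕ → S → X × Y}
    (hf : IsProperClosedConvex f) (hg : IsProperClosedConvex g)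
    (cf : IsCompact (effDom f)) (cg : IsCompact (effDom g)) (τ_pos : 0 < τ) (σ_pos : 0 < σ)
    (hGx : Measurable fun p : X × Y × Wx => Gx p.1 p.2.1 p.2.2)
    (hGy : Measurable fun p : X × Y × Wy => Gy p.1 p.2.1 p.2.2)
    (h0 : Measurable (z 0))
    (hz : ∀ s, IsTrajectory f g τ σ (fun n => z n s)
      (fun n => Gy (z n s).1 (z n s).2 (ωy n s))
      (fun n => Gx (z (n + 1) s).1 (z (n + 2) s).2 (ωx n s))) :
    ∀ n, ((∀ k, k + 1 < n → Measurable (ωx k)) → (∀ k < n, Measurable (ωy k)) →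
        Measurable (z n)) ∧
      ((∀ k, k + 1 < n → Measurable (ωx k)) → (∀ k < n + 1, Measurable (ωy k)) →
        Measurable fun s => (z (n + 1) s).2) := by
  have hy : ∀ n, Measurable (z n) → Measurable (z (n + 1)) → Measurable (ωy n) →
      Measurable (ωy (n + 1)) → Measurable fun s => (z (n + 2) s).2 := by
    intro n m0 m1 w0 w1
    have e : (fun s => (z (n + 2) s).2) = fun s => prox (fun v => (σ : EReal) * g v)
        ((z (n + 1) s).2 + σ • (Gy (z (n + 1) s).1 (z (n + 1) s).2 (ωy (n + 1) s)
          + (Gy (z (n + 1) s).1 (z (n + 1) s).2 (ωy (n + 1) s)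
            - Gy (z n s).1 (z n s).2 (ωy n s)))) := funext fun s => (hz s).step_y n
    rw [e]
    have a0 := hGy.comp (m0.fst.prodMk (m0.snd.prodMk w0))
    have a1 := hGy.comp (m1.fst.prodMk (m1.snd.prodMk w1))
    exact (continuous_prox hg cg σ_pos).measurable.comp
      (m1.snd.add ((a1.add (a1.sub a0)).const_smul σ))
  have hx : ∀ n, Measurable (z (n + 1)) → (Measurable fun s => (z (n + 2) s).2) →
      Measurable (ωx n) → Measurable (z (n + 2)) := by
    intro n m1 m2 w
    refine Measurable.prod ?_ m2
    have e : (fun s => (z (n + 2) s).1) = fun s => prox (fun u => (τ : EReal) * f u)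
        ((z (n + 1) s).1 - τ • Gx (z (n + 1) s).1 (z (n + 2) s).2 (ωx n s)) :=
      funext fun s => (hz s).step_x n
    rw [e]
    have b := hGx.comp (m1.fst.prodMk (m2.prodMk w))
    exact (continuous_prox hf cf τ_pos).measurable.comp (m1.fst.sub (b.const_smul τ))
  have h1 : Measurable (z 1) := by
    rwa [show z 1 = z 0 from funext fun s => (hz s).init]
  have main : ∀ n, (∀ k, k + 1 < n → Measurable (ωx k)) → (∀ k < n, Measurable (ωy k)) →
      Measurable (z n) := by
    intro n
    induction n using Nat.twoStepInduction with
    | zero => exact fun _ _ => h0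
    | one => exact fun _ _ => h1
    | more n ih0 ih1 =>
      intro kx ky
      have m0 := ih0 (fun k hk => kx k (by lia)) (fun k hk => ky k (by lia))
      have m1 := ih1 (fun k hk => kx k (by lia)) (fun k hk => ky k (by lia))
      exact hx n m1 (hy n m0 m1 (ky n (by lia)) (ky (n + 1) (by lia))) (kx n (by lia))
  intro n
  refine ⟨main n, fun kx ky => ?_⟩
  cases n with
  | zero => exact h1.snd
  | succ n =>
    exact hy n (main n (fun k hk => kx k (by lia)) (fun k hk => ky k (by lia)))
      (main (n + 1) kx (fun k hk => ky k (by lia))) (ky n (by lia)) (ky (n + 1) (by lia))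

end Measurability

/-! ### The filtration generated by one sample sequence and all of the other. -/

section Past

variable {α β S : Type*} [MeasurableSpace α] [MeasurableSpace β] {A : S → α} {ω : ℕ → S → β}

/-- The information carried by `A` and by the samples of `ω` before time `n`. -/
abbrev past (A : S → α) (ω : ℕ → S → β) (n : ℕ) : MeasurableSpace S :=
  MeasurableSpace.comap (fun s => (A s, fun j : Finset.range n => ω j s)) inferInstance

theorem measurable_past_left (n : ℕ) : Measurable[past A ω n] A :=
  measurable_fst.comp (comap_measurable fun s => (A s, fun j : Finset.range n => ω j s))

theorem measurable_past_right {n k : ℕ} (hk : k < n) : Measurable[past A ω n] (ω k) :=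
  ((measurable_pi_apply (⟨k, by simpa using hk⟩ : Finset.range n)).comp measurable_snd).comp
    (comap_measurable fun s => (A s, fun j : Finset.range n => ω j s))

theorem past_le {mS : MeasurableSpace S} (hA : Measurable A) (hω : ∀ n, Measurable (ω n)) (n : ℕ) :
    past A ω n ≤ mS :=
  Measurable.comap_le (f := fun s => (A s, fun j : Finset.range n => ω j s))
    (hA.prodMk (measurable_pi_lambda _ fun j => hω j))

theorem indep_past {mS : MeasurableSpace S} {P : Measure S} [IsProbabilityMeasure P]
    (hA : Measurable A) (hω : ∀ n, Measurable (ω n))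
    (h1 : IndepFun A (fun s n => ω n s) P) (h2 : iIndepFun ω P) (n : ℕ) :
    Indep (past A ω n) (MeasurableSpace.comap (ω n) inferInstance) P :=
  (IndepFun_iff_Indep _ _ _).1 (indepFun_past hA hω h1 h2 n)

end Past

/-! ### Measurability of the surrogates. -/

section HatMeasurability

variable {X Y S : Type*} {mS : MeasurableSpace S}
  [NormedAddCommGroup X] [InnerProductSpace ℝ X] [FiniteDimensional ℝ X]
  [MeasurableSpace X] [BorelSpace X]
  [NormedAddCommGroup Y] [InnerProductSpace ℝ Y] [FiniteDimensional ℝ Y]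
  [MeasurableSpace Y] [BorelSpace Y]
  {f : X → EReal} {g : Y → EReal} {Φ : X → Y → ℝ} {Lxx Lxy Lyx Lyy : ℝ} {τ σ : ℝ}
  {z : ℕ → S → X × Y} {a : ℕ → S → Y} {b : ℕ → S → X}

theorem measurable_hatX (H : IsSmoothConvexConcave f g Φ Lxx Lxy Lyx Lyy)
    (cf : IsCompact (effDom f)) (τ_pos : 0 < τ) {n : ℕ}
    (hmem : ∀ n s, (z n s).1 ∈ effDom f ∧ (z n s).2 ∈ effDom g)
    (h1 : Measurable (z (n + 1))) (h2 : Measurable fun s => (z (n + 2) s).2) :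
    Measurable fun s => hatX f Φ τ (fun n => z n s) n :=
  (continuous_prox H.f_convex cf τ_pos).measurable.comp (h1.fst.sub
    ((H.measurable_gradX (h1.fst.prodMk h2) fun s =>
      ⟨(hmem (n + 1) s).1, (hmem (n + 2) s).2⟩).const_smul τ))

theorem measurable_hatY (H : IsSmoothConvexConcave f g Φ Lxx Lxy Lyx Lyy)
    (cg : IsCompact (effDom g)) (σ_pos : 0 < σ) {n : ℕ}
    (hmem : ∀ n s, (z n s).1 ∈ effDom f ∧ (z n s).2 ∈ effDom g)
    (h1 : Measurable (z (n + 1))) (ha : Measurable (a n)) :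
    Measurable fun s => hatY g Φ σ (fun n => z n s) (fun n => a n s) n :=
  (continuous_prox H.g_convex cg σ_pos).measurable.comp (h1.snd.add
    ((((H.measurable_gradY h1 (hmem (n + 1))).const_smul (2 : ℝ)).sub ha).const_smul σ))

theorem measurable_hatZ (H : IsSmoothConvexConcave f g Φ Lxx Lxy Lyx Lyy)
    (cf : IsCompact (effDom f)) (cg : IsCompact (effDom g)) (τ_pos : 0 < τ) (σ_pos : 0 < σ)
    (hmem : ∀ n s, (z n s).1 ∈ effDom f ∧ (z n s).2 ∈ effDom g) {n : ℕ}
    (hz : ∀ k ≤ n, Measurable (z k)) (ha : ∀ k < n, Measurable (a k)) :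
    Measurable fun s => hatZ f g Φ τ σ (fun n => z n s) (fun n => a n s) n := by
  cases n with
  | zero => exact hz 0 le_rfl
  | succ n =>
    have h1 := hz (n + 1) le_rfl
    have hY := measurable_hatY H cg σ_pos hmem h1 (ha n (Nat.lt_succ_self n))
    refine Measurable.prodMk ?_ hY
    exact (continuous_prox H.f_convex cf τ_pos).measurable.comp (h1.fst.sub
      ((H.measurable_gradX (h1.fst.prodMk hY) fun s =>
        ⟨(hmem (n + 1) s).1, prox_mem H.g_convex cg σ_pos _⟩).const_smul τ))

/-- Only dual outputs strictly before `n` enter, so this surrogate of iterate `n + 2` belongs to the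
past of dual sample `n`. -/
theorem measurable_hatY₂ (H : IsSmoothConvexConcave f g Φ Lxx Lxy Lyx Lyy)
    (cf : IsCompact (effDom f)) (cg : IsCompact (effDom g)) (τ_pos : 0 < τ) (σ_pos : 0 < σ)
    (hz' : ∀ s, IsTrajectory f g τ σ (fun n => z n s) (fun n => a n s) (fun n => b n s)) {n : ℕ}
    (hz : ∀ k ≤ n, Measurable (z k)) (ha : ∀ k < n, Measurable (a k)) :
    Measurable fun s => hatY₂ f g Φ τ σ (fun n => z n s) (fun n => a n s) n := by
  have hmem : ∀ n s, (z n s).1 ∈ effDom f ∧ (z n s).2 ∈ effDom g := fun n s =>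
    (hz' s).mem H.f_convex H.g_convex cf cg τ_pos σ_pos n
  have hZ := measurable_hatZ H cf cg τ_pos σ_pos hmem hz ha
  exact (continuous_prox H.g_convex cg σ_pos).measurable.comp (hZ.snd.add
    ((((H.measurable_gradY hZ fun s => hatZ_mem H cf cg τ_pos σ_pos (hz' s) n).const_smul
      (2 : ℝ)).sub (H.measurable_gradY (hz n le_rfl) (hmem n))).const_smul σ))

end HatMeasurability

/-! ### Bookkeeping for integrable functions with bounded mean. -/

section MeanLE

variable {S : Type*} [MeasurableSpace S] {P : Measure S}

/-- `φ` is integrable with mean at most `c`. -/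
def MeanLE (P : Measure S) (φ : S → ℝ) (c : ℝ) : Prop := Integrable φ P ∧ ∫ s, φ s ∂P ≤ c

theorem MeanLE.add {φ ψ : S → ℝ} {c d : ℝ} (h : MeanLE P φ c) (k : MeanLE P ψ d) :
    MeanLE P (fun s => φ s + ψ s) (c + d) :=
  ⟨h.1.add k.1, by rw [integral_add h.1 k.1]; exact add_le_add h.2 k.2⟩

theorem MeanLE.const_mul {φ : S → ℝ} {c r : ℝ} (h : MeanLE P φ c) (hr : 0 ≤ r) :
    MeanLE P (fun s => r * φ s) (r * c) :=
  ⟨h.1.const_mul r, by rw [integral_const_mul]; exact mul_le_mul_of_nonneg_left h.2 hr⟩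

theorem MeanLE.sum {φ : ℕ → S → ℝ} {c : ℝ} (h : ∀ n, MeanLE P (φ n) c) (N : ℕ) :
    MeanLE P (fun s => ∑ n ∈ Finset.range N, φ n s) (N * c) := by
  induction N with
  | zero => exact ⟨by simp, by simp⟩
  | succ N ih =>
    have := ih.add (h N)
    simp only [Finset.sum_range_succ]
    refine ⟨this.1, this.2.trans (le_of_eq ?_)⟩
    push_cast
    ring

theorem MeanLE.const [IsProbabilityMeasure P] (c : ℝ) : MeanLE P (fun _ => c) c :=
  ⟨integrable_const c, by simp⟩

theorem MeanLE.of_integral_eq_zero {φ : S → ℝ} (h : Integrable φ P) (h0 : ∫ s, φ s ∂P = 0)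
    (r : ℝ) : MeanLE P (fun s => r * φ s) 0 :=
  ⟨h.const_mul r, by rw [integral_const_mul, h0, mul_zero]⟩

end MeanLE

/-! ### The mean of the noise bound. -/

section Expectation

variable {X Y Wx Wy S : Type*}
  [NormedAddCommGroup X] [InnerProductSpace ℝ X] [FiniteDimensional ℝ X]
  [MeasurableSpace X] [BorelSpace X]
  [NormedAddCommGroup Y] [InnerProductSpace ℝ Y] [FiniteDimensional ℝ Y]
  [MeasurableSpace Y] [BorelSpace Y]
  [MeasurableSpace Wx] [MeasurableSpace Wy] {m mS : MeasurableSpace S}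
  {P : Measure S} [IsProbabilityMeasure P]
  {f : X → EReal} {g : Y → EReal} {Φ : X → Y → ℝ} {Lxx Lxy Lyx Lyy Ωf Ωg δx δy τ σ : ℝ}
  {Gx : X → Y → Wx → X} {Gy : X → Y → Wy → Y} {ωx : ℕ → S → Wx} {ωy : ℕ → S → Wy}
  {z : ℕ → S → X × Y} {x₀ : X} {y₀ : Y}

/-- A random trajectory of the primal-dual iteration with momentum one, admissible step sizes and
unbiased oracles of bounded variance. -/
structure IsStochasticTrajectory (P : Measure S) (f : X → EReal) (g : Y → EReal) (Φ : X → Y → ℝ)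
    (Lxx Lxy Lyx Lyy Ωf Ωg δx δy τ σ : ℝ) (Gx : X → Y → Wx → X) (Gy : X → Y → Wy → Y)
    (ωx : ℕ → S → Wx) (ωy : ℕ → S → Wy) (x₀ : X) (y₀ : Y) (z : ℕ → S → X × Y) : Prop where
  smooth : IsSmoothConvexConcave f g Φ Lxx Lxy Lyx Lyy
  domains : HasCompactDomains f g Ωf Ωg
  compact_f : IsCompact (effDom f)
  compact_g : IsCompact (effDom g)
  τ_pos : 0 < τ
  σ_pos : 0 < σ
  τ_le : τ * (Lyx + Lxx) ≤ 1
  σ_le : σ * (Lyx + 2 * Lyy) ≤ 1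
  σ_le' : σ * Lxy ≤ 1
  init : z 0 = fun _ => (x₀, y₀)
  trajectory : ∀ s, IsTrajectory f g τ σ (fun n => z n s)
    (fun n => Gy (z n s).1 (z n s).2 (ωy n s))
    (fun n => Gx (z (n + 1) s).1 (z (n + 2) s).2 (ωx n s))
  noise : IsUnbiasedBoundedNoise P Φ Gx Gy ωx ωy z δx δy

namespace IsStochasticTrajectory

variable (T : IsStochasticTrajectory P f g Φ Lxx Lxy Lyx Lyy Ωf Ωg δx δy τ σ Gx Gy ωx ωy x₀ y₀ z)

/-- The error of the primal oracle. -/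
noncomputable def errX (Φ : X → Y → ℝ) (Gx : X → Y → Wx → X) (ωx : ℕ → S → Wx) (z : ℕ → S → X × Y)
    (n : ℕ) (s : S) : X :=
  Gx (z (n + 1) s).1 (z (n + 2) s).2 (ωx n s) - gradX Φ (z (n + 1) s).1 (z (n + 2) s).2

/-- The error of the dual oracle. -/
noncomputable def errY (Φ : X → Y → ℝ) (Gy : X → Y → Wy → Y) (ωy : ℕ → S → Wy) (z : ℕ → S → X × Y)
    (n : ℕ) (s : S) : Y :=
  Gy (z n s).1 (z n s).2 (ωy n s) - gradY Φ (z n s).1 (z n s).2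

include T

theorem mem (n : ℕ) (s : S) : (z n s).1 ∈ effDom f ∧ (z n s).2 ∈ effDom g :=
  (T.trajectory s).mem T.smooth.f_convex T.smooth.g_convex T.compact_f T.compact_g T.τ_pos
    T.σ_pos n

theorem measurable_z {n : ℕ} (hx : ∀ k, k + 1 < n → Measurable[m] (ωx k))
    (hy : ∀ k < n, Measurable[m] (ωy k)) : Measurable[m] (z n) :=
  (measurable_trajectory T.smooth.f_convex T.smooth.g_convex T.compact_f T.compact_g T.τ_pos
    T.σ_pos T.noise.measurable_Gx T.noise.measurable_Gy (by rw [T.init]; exact measurable_const)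
    T.trajectory n).1 hx hy

theorem measurable_z_snd {n : ℕ}
    (hx : ∀ k, k + 1 < n → Measurable[m] (ωx k))
    (hy : ∀ k < n + 1, Measurable[m] (ωy k)) : Measurable[m] fun s => (z (n + 1) s).2 :=
  (measurable_trajectory T.smooth.f_convex T.smooth.g_convex T.compact_f T.compact_g T.τ_pos
    T.σ_pos T.noise.measurable_Gx T.noise.measurable_Gy (by rw [T.init]; exact measurable_const)
    T.trajectory n).2 hx hy

theorem measurable_oracleY {n : ℕ} (hz : Measurable[m] (z n))
    (hy : Measurable[m] (ωy n)) : Measurable[m] fun s => Gy (z n s).1 (z n s).2 (ωy n s) :=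
  T.noise.measurable_Gy.comp (hz.fst.prodMk (hz.snd.prodMk hy))

theorem measurable_errY {n : ℕ} (hz : Measurable[m] (z n))
    (hy : Measurable[m] (ωy n)) : Measurable[m] (errY Φ Gy ωy z n) :=
  (T.measurable_oracleY hz hy).sub (T.smooth.measurable_gradY hz (T.mem n))

theorem measurable_errX {n : ℕ} (h1 : Measurable[m] (z (n + 1)))
    (h2 : Measurable[m] fun s => (z (n + 2) s).2) (hx : Measurable[m] (ωx n)) :
    Measurable[m] (errX Φ Gx ωx z n) :=
  (T.noise.measurable_Gx.comp (h1.fst.prodMk (h2.prodMk hx))).sub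
    (T.smooth.measurable_gradX (h1.fst.prodMk h2) fun s =>
      ⟨(T.mem (n + 1) s).1, (T.mem (n + 2) s).2⟩)

theorem measurable_z' (n : ℕ) : Measurable (z n) :=
  T.measurable_z (fun k _ => T.noise.measurable_ωx k) fun k _ => T.noise.measurable_ωy k

theorem measurable_errX' (n : ℕ) : Measurable (errX Φ Gx ωx z n) :=
  T.measurable_errX (T.measurable_z' _) (T.measurable_z' _).snd (T.noise.measurable_ωx n)

theorem measurable_errY' (n : ℕ) : Measurable (errY Φ Gy ωy z n) :=
  T.measurable_errY (T.measurable_z' _) (T.noise.measurable_ωy n)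

theorem memLp_errX (n : ℕ) : MemLp (errX Φ Gx ωx z n) 2 P :=
  (memLp_two_iff_integrable_sq_norm (T.measurable_errX' n).aestronglyMeasurable).2
    (T.noise.sq_integrable_x n)

theorem memLp_errY (n : ℕ) : MemLp (errY Φ Gy ωy z n) 2 P :=
  (memLp_two_iff_integrable_sq_norm (T.measurable_errY' n).aestronglyMeasurable).2
    (T.noise.sq_integrable_y n)

theorem meanLE_errX_sq (n : ℕ) : MeanLE P (fun s => ‖errX Φ Gx ωx z n s‖ ^ 2) (δx ^ 2) :=
  ⟨T.noise.sq_integrable_x n, integral_le_of_condExp_le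
    (((T.measurable_z' (n + 1)).fst.prodMk (T.measurable_z' (n + 2)).snd).comap_le)
    (T.noise.variance_x n)⟩

theorem meanLE_errY_sq (n : ℕ) : MeanLE P (fun s => ‖errY Φ Gy ωy z n s‖ ^ 2) (δy ^ 2) :=
  ⟨T.noise.sq_integrable_y n, integral_le_of_condExp_le (T.measurable_z' n).comap_le
    (T.noise.variance_y n)⟩

theorem measurable_all_ωx : Measurable fun s k => ωx k s :=
  measurable_pi_lambda _ T.noise.measurable_ωx

theorem measurable_all_ωy : Measurable fun s k => ωy k s :=
  measurable_pi_lambda _ T.noise.measurable_ωy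

/-- The primal past may contain the entire dual sequence because the two sequences are independent.
Thus even the updated dual point at which the primal oracle is queried belongs to it. -/
theorem measurable_z_pastX {n k : ℕ} (hk : k ≤ n + 1) :
    Measurable[past (fun s k => ωy k s) ωx n] (z k) :=
  T.measurable_z (fun j hj => measurable_past_right (by lia))
    fun j _ => (measurable_pi_apply j).comp (measurable_past_left (A := fun s k => ωy k s) n)

theorem measurable_z_snd_pastX {n k : ℕ} (hk : k ≤ n + 1) :
    Measurable[past (fun s k => ωy k s) ωx n] fun s => (z (k + 1) s).2 :=
  T.measurable_z_snd (fun j hj => measurable_past_right (by lia))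
    fun j _ => (measurable_pi_apply j).comp (measurable_past_left (A := fun s k => ωy k s) n)

theorem measurable_z_pastY {n k : ℕ} (hk : k ≤ n) :
    Measurable[past (fun s k => ωx k s) ωy n] (z k) :=
  T.measurable_z
    (fun j _ => (measurable_pi_apply j).comp (measurable_past_left (A := fun s k => ωx k s) n))
    fun j hj => measurable_past_right (by lia)

theorem integral_inner_errX {n : ℕ} {V : S → X}
    (hV : Measurable[past (fun s k => ωy k s) ωx n] V) (hV2 : MemLp V 2 P) :
    Integrable (fun s => ⟪errX Φ Gx ωx z n s, V s⟫_ℝ) P ∧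
      ∫ s, ⟪errX Φ Gx ωx z n s, V s⟫_ℝ ∂P = 0 := by
  have hint := integrable_inner_of_memLp (T.memLp_errX n) hV2
  refine ⟨hint, ?_⟩
  have hG : Measurable fun p : (X × Y) × Wx => Gx p.1.1 p.1.2 p.2 :=
    T.noise.measurable_Gx.comp
      (measurable_fst.fst.prodMk (measurable_fst.snd.prodMk measurable_snd))
  exact integral_inner_oracle_error (past_le T.measurable_all_ωy T.noise.measurable_ωx n)
    (T.noise.measurable_ωx n)
    (indep_past T.measurable_all_ωy T.noise.measurable_ωx T.noise.indep_xy.symm T.noise.indep_x n)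
    (u := fun s => ((z (n + 1) s).1, (z (n + 2) s).2))
    ((T.measurable_z_pastX le_rfl).fst.prodMk (T.measurable_z_snd_pastX le_rfl)) hG
    (T.noise.integrable_x n) (T.noise.unbiased_x n) hV hint

theorem integral_inner_errY {n : ℕ} {V : S → Y}
    (hV : Measurable[past (fun s k => ωx k s) ωy n] V) (hV2 : MemLp V 2 P) :
    Integrable (fun s => ⟪errY Φ Gy ωy z n s, V s⟫_ℝ) P ∧
      ∫ s, ⟪errY Φ Gy ωy z n s, V s⟫_ℝ ∂P = 0 := by
  have hint := integrable_inner_of_memLp (T.memLp_errY n) hV2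
  refine ⟨hint, ?_⟩
  have hG : Measurable fun p : (X × Y) × Wy => Gy p.1.1 p.1.2 p.2 :=
    T.noise.measurable_Gy.comp
      (measurable_fst.fst.prodMk (measurable_fst.snd.prodMk measurable_snd))
  exact integral_inner_oracle_error (past_le T.measurable_all_ωx T.noise.measurable_ωy n)
    (T.noise.measurable_ωy n)
    (indep_past T.measurable_all_ωx T.noise.measurable_ωy T.noise.indep_xy T.noise.indep_y n)
    (u := z n) (T.measurable_z_pastY le_rfl) hG
    (T.noise.integrable_y n) (T.noise.unbiased_y n) hV hint

theorem meanLE_sum_errX (N : ℕ) :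
    MeanLE P (fun s => ‖∑ n ∈ Finset.range N, errX Φ Gx ωx z n s‖ ^ 2) (N * δx ^ 2) := by
  refine integral_norm_sum_sq_le (fun k => (T.measurable_errX' k).aestronglyMeasurable)
    (fun k => (T.meanLE_errX_sq k).1) (fun k => (T.meanLE_errX_sq k).2) (fun k => ?_) N
  refine (T.integral_inner_errX ?_ (memLp_finsetSum _ fun j _ => T.memLp_errX j)).2
  refine Finset.measurable_fun_sum _ fun j hj => ?_
  have hj' : j < k := by simpa using hj
  exact T.measurable_errX (T.measurable_z_pastX (by lia)) (T.measurable_z_snd_pastX (by lia))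
    (measurable_past_right hj')

/-- The momentum noise `2 ny (n + 1) - ny n` mixes two times and is not a sequence of orthogonal
increments; its two parts are, and the shift `i` serves both. -/
theorem meanLE_sum_errY (i N : ℕ) :
    MeanLE P (fun s => ‖∑ n ∈ Finset.range N, errY Φ Gy ωy z (n + i) s‖ ^ 2) (N * δy ^ 2) := by
  refine integral_norm_sum_sq_le (n := fun n => errY Φ Gy ωy z (n + i))
    (fun k => (T.measurable_errY' _).aestronglyMeasurable)
    (fun k => (T.meanLE_errY_sq _).1) (fun k => (T.meanLE_errY_sq _).2) (fun k => ?_) N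
  refine (T.integral_inner_errY ?_ (memLp_finsetSum _ fun j _ => T.memLp_errY _)).2
  refine Finset.measurable_fun_sum _ fun j hj => ?_
  have hj' : j < k := by simpa using hj
  exact T.measurable_errY (T.measurable_z_pastY (by lia)) (measurable_past_right (by lia))

theorem past_measurable_of_pastX {E : Type*} [MeasurableSpace E] {n : ℕ} {V : S → E}
    (hV : Measurable[past (fun s k => ωy k s) ωx n] V) : Measurable V :=
  hV.mono (past_le T.measurable_all_ωy T.noise.measurable_ωx n) le_rfl

theorem past_measurable_of_pastY {E : Type*} [MeasurableSpace E] {n : ℕ} {V : S → E}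
    (hV : Measurable[past (fun s k => ωx k s) ωy n] V) : Measurable V :=
  hV.mono (past_le T.measurable_all_ωx T.noise.measurable_ωy n) le_rfl

/-- Primal errors are orthogonal to past points of the domain. -/
theorem meanLE_inner_errX {n : ℕ} {V : S → X} (r : ℝ)
    (hV : Measurable[past (fun s k => ωy k s) ωx n] V) (hmem : ∀ s, V s ∈ effDom f) :
    MeanLE P (fun s => r * ⟪errX Φ Gx ωx z n s, V s - (z 0 s).1⟫_ℝ) 0 := by
  have hm : Measurable[past (fun s k => ωy k s) ωx n] fun s => V s - (z 0 s).1 :=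
    hV.sub (T.measurable_z_pastX (by lia)).fst
  have h2 : MemLp (fun s => V s - (z 0 s).1) 2 P :=
    MemLp.of_bound (T.past_measurable_of_pastX hm).aestronglyMeasurable (√Ωf)
      (ae_of_all _ fun s => Real.le_sqrt_of_sq_le (T.domains.diam_f _ (hmem s) _ (T.mem 0 s).1))
  exact MeanLE.of_integral_eq_zero (T.integral_inner_errX hm h2).1 (T.integral_inner_errX hm h2).2 r

/-- Dual errors are orthogonal to past points of the domain. -/
theorem meanLE_inner_errY {n : ℕ} {V : S → Y} (r : ℝ)
    (hV : Measurable[past (fun s k => ωx k s) ωy n] V) (hmem : ∀ s, V s ∈ effDom g) :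
    MeanLE P (fun s => r * ⟪errY Φ Gy ωy z n s, V s - (z 0 s).2⟫_ℝ) 0 := by
  have hm : Measurable[past (fun s k => ωx k s) ωy n] fun s => V s - (z 0 s).2 :=
    hV.sub (T.measurable_z_pastY (by lia)).snd
  have h2 : MemLp (fun s => V s - (z 0 s).2) 2 P :=
    MemLp.of_bound (T.past_measurable_of_pastY hm).aestronglyMeasurable (√Ωg)
      (ae_of_all _ fun s => Real.le_sqrt_of_sq_le (T.domains.diam_g _ (hmem s) _ (T.mem 0 s).2))
  exact MeanLE.of_integral_eq_zero (T.integral_inner_errY hm h2).1 (T.integral_inner_errY hm h2).2 r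

theorem meanLE_prevNoise (n : ℕ) :
    MeanLE P (fun s => ‖prevNoise (fun n => errX Φ Gx ωx z n s) n‖ ^ 2) (δx ^ 2) := by
  cases n with
  | zero => exact ⟨by simp [prevNoise], by simp [prevNoise, sq_nonneg]⟩
  | succ n => exact T.meanLE_errX_sq n

/-- The random bound on the gap has an integrable majorant of controlled mean. -/
theorem exists_meanLE_noiseBound (N : ℕ) : ∃ B : S → ℝ,
    MeanLE P B (N * (5 / 2 * (τ * δx ^ 2) + 21 * (σ * δy ^ 2)) + (Ωf / τ + Ωg / σ)) ∧
    ∀ s, noiseBound τ σ Ωf Ωg (z 0 s) (fun n => z n s) (fun n => errX Φ Gx ωx z n s)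
      (fun n => errY Φ Gy ωy z n s) N ≤ B s := by
  have hτ := T.τ_pos.le
  have hσ := T.σ_pos.le
  let a : ℕ → S → Y := fun n s => Gy (z n s).1 (z n s).2 (ωy n s)
  have ma : ∀ {n k : ℕ}, k < n → Measurable[past (fun s k => ωx k s) ωy n] (a k) := fun hk =>
    T.measurable_oracleY (T.measurable_z_pastY hk.le) (measurable_past_right hk)
  have m1 : ∀ n, MeanLE P (fun s => (-1) * ⟪errX Φ Gx ωx z n s,
      hatX f Φ τ (fun n => z n s) n - (z 0 s).1⟫_ℝ) 0 := fun n =>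
    T.meanLE_inner_errX (-1) (measurable_hatX T.smooth T.compact_f T.τ_pos T.mem
      (T.measurable_z_pastX le_rfl) (T.measurable_z_snd_pastX le_rfl))
      fun s => prox_mem T.smooth.f_convex T.compact_f T.τ_pos _
  have m2 : ∀ n, MeanLE P (fun s => 2 * ⟪errY Φ Gy ωy z (n + 1) s,
      hatY g Φ σ (fun n => z n s) (fun n => a n s) n - (z 0 s).2⟫_ℝ) 0 := fun n =>
    T.meanLE_inner_errY 2 (measurable_hatY T.smooth T.compact_g T.σ_pos T.mem
      (T.measurable_z_pastY le_rfl) (ma (Nat.lt_succ_self n)))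
      fun s => prox_mem T.smooth.g_convex T.compact_g T.σ_pos _
  have m3 : ∀ n, MeanLE P (fun s => (-1) * ⟪errY Φ Gy ωy z n s,
      hatY₂ f g Φ τ σ (fun n => z n s) (fun n => a n s) n - (z 0 s).2⟫_ℝ) 0 := fun n =>
    T.meanLE_inner_errY (-1) (measurable_hatY₂ T.smooth T.compact_f T.compact_g T.τ_pos T.σ_pos
      T.trajectory (fun k hk => T.measurable_z_pastY hk) (fun k hk => ma hk))
      fun s => prox_mem T.smooth.g_convex T.compact_g T.σ_pos _
  have m4 : ∀ n, MeanLE P _ _ := fun n => ((((((m1 n).add (m2 n)).add (m3 n)).add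
    ((T.meanLE_errX_sq n).const_mul hτ)).add ((T.meanLE_prevNoise n).const_mul hτ)).add
    ((T.meanLE_errY_sq (n + 1)).const_mul (by positivity : 0 ≤ 5 * σ))).add
    ((T.meanLE_errY_sq n).const_mul (by positivity : 0 ≤ 11 * σ))
  -- The constants add up to `1 + 1 + 1/2 = 5/2` for `τ * δx ^ 2` and `5 + 11 + 4 + 1 = 21` for `σ *
  -- δy ^ 2`; the `4` and `1` come from splitting the squared momentum sum below.
  have m5 := (((MeanLE.sum m4 N).add
    ((T.meanLE_sum_errX N).const_mul (by positivity : 0 ≤ τ / 2))).add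
    (((T.meanLE_sum_errY 1 N).const_mul (by positivity : 0 ≤ 4 * σ)).add
      ((T.meanLE_sum_errY 0 N).const_mul (by positivity : 0 ≤ σ)))).add
    (MeanLE.const (P := P) (Ωf / τ + Ωg / σ))
  refine ⟨_, ⟨m5.1, m5.2.trans (le_of_eq (by ring))⟩, fun s => ?_⟩
  unfold noiseBound
  refine add_le_add (add_le_add (add_le_add ?_ le_rfl) ?_) le_rfl
  · refine Finset.sum_le_sum fun n _ => ?_
    have := noise_step_le T.smooth T.compact_f T.compact_g T.τ_pos T.σ_pos T.τ_le T.σ_le T.σ_le'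
      (T.trajectory s) (nx := fun n => errX Φ Gx ωx z n s) (ny := fun n => errY Φ Gy ωy z n s)
      rfl rfl (z 0 s) n
    linarith
  · rw [Finset.sum_sub_distrib, ← Finset.smul_sum]
    simp only [add_zero]
    generalize ∑ n ∈ Finset.range N, errY Φ Gy ωy z (n + 1) s = p
    generalize ∑ n ∈ Finset.range N, errY Φ Gy ωy z n s = q
    have h1 := parallelogram_law_with_norm ℝ ((2 : ℝ) • p) q
    rw [norm_smul, Real.norm_of_nonneg zero_le_two] at h1
    have h2 : ‖(2 : ℝ) • p - q‖ ^ 2 ≤ 8 * ‖p‖ ^ 2 + 2 * ‖q‖ ^ 2 := by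
      nlinarith [mul_self_nonneg ‖(2 : ℝ) • p + q‖]
    have h3 := mul_le_mul_of_nonneg_left h2 (by positivity : 0 ≤ σ / 2)
    linarith

end IsStochasticTrajectory

end Expectation

/-! ### The extended-real gap: real-valued bounds and measurability. -/

section Gap

variable {X Y : Type*}
  [NormedAddCommGroup X] [InnerProductSpace ℝ X] [FiniteDimensional ℝ X]
  [NormedAddCommGroup Y] [InnerProductSpace ℝ Y] [FiniteDimensional ℝ Y]
  {f : X → EReal} {g : Y → EReal} {Φ : X → Y → ℝ} {Lxx Lxy Lyx Lyy : ℝ}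

theorem IsSmoothConvexConcave.coe_realLagrangian
    (H : IsSmoothConvexConcave f g Φ Lxx Lxy Lyx Lyy) {x : X} {y : Y} (hx : x ∈ effDom f)
    (hy : y ∈ effDom g) : lagrangian f g Φ x y = (realLagrangian f g Φ x y : EReal) := by
  rw [lagrangian, realLagrangian, ← H.f_convex.coe_toReal hx, ← H.g_convex.coe_toReal hy]
  norm_cast

/-- At points of the domain, only test points of the domain contribute to the gap. -/
theorem iSup_lagrangian_sub_eq (H : IsSmoothConvexConcave f g Φ Lxx Lxy Lyx Lyy) {p : X × Y}
    (hp : p.1 ∈ effDom f ∧ p.2 ∈ effDom g) :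
    (⨆ (x : X) (y : Y), (lagrangian f g Φ p.1 y - lagrangian f g Φ x p.2))
      = ⨆ (u : effDom f) (v : effDom g),
        ((realLagrangian f g Φ p.1 v - realLagrangian f g Φ u p.2 : ℝ) : EReal) := by
  refine le_antisymm (iSup_le fun x => iSup_le fun y => ?_) (iSup_le fun u => iSup_le fun v => ?_)
  · by_cases hx : x ∈ effDom f
    · by_cases hy : y ∈ effDom g
      · refine le_trans (le_of_eq ?_) (le_iSup₂ (α := EReal) (⟨x, hx⟩ : effDom f)
          (⟨y, hy⟩ : effDom g))
        rw [H.coe_realLagrangian hp.1 hy, H.coe_realLagrangian hx hp.2]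
        norm_cast
      · have h1 : g y = ⊤ := by simpa [effDom] using hy
        rw [H.coe_realLagrangian hx hp.2]
        simp [lagrangian, h1]
    · have h1 : f x = ⊤ := by simpa [effDom] using hx
      have h2 : lagrangian f g Φ x p.2 = ⊤ := by
        rw [lagrangian, h1, ← H.g_convex.coe_toReal hp.2, EReal.top_add_coe, EReal.top_sub_coe]
      simp [h2]
  · refine le_trans (le_of_eq ?_) (le_iSup₂ (α := EReal) (u : X) (v : Y))
    rw [H.coe_realLagrangian hp.1 v.2, H.coe_realLagrangian u.2 hp.2]
    norm_cast

theorem primalDualGap_le (H : IsSmoothConvexConcave f g Φ Lxx Lxy Lyx Lyy) {p : X × Y}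
    (hp : p.1 ∈ effDom f ∧ p.2 ∈ effDom g) {r : ℝ}
    (hr : ∀ u ∈ effDom f, ∀ v ∈ effDom g,
      realLagrangian f g Φ p.1 v - realLagrangian f g Φ u p.2 ≤ r) :
    primalDualGap f g Φ p.1 p.2 ≤ ENNReal.ofReal r := by
  have e : ENNReal.ofReal r = (r : EReal).toENNReal := by
    rw [EReal.toENNReal_of_ne_top (EReal.coe_ne_top r), EReal.toReal_coe]
  rw [primalDualGap, iSup_lagrangian_sub_eq H hp, e]
  refine EReal.toENNReal_le_toENNReal (iSup_le fun u => iSup_le fun v => ?_)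
  exact EReal.coe_le_coe_iff.2 (hr u u.2 v v.2)

/-- The supremum is uncountable, so semicontinuity is used: regrouped, each member is `f q.1 + g
q.2` plus a continuous real function. The supremum of such functions is lower semicontinuous, hence
Borel. -/
theorem measurable_primalDualGap_comp [MeasurableSpace X] [BorelSpace X] [MeasurableSpace Y]
    [BorelSpace Y] {S : Type*} [MeasurableSpace S]
    (H : IsSmoothConvexConcave f g Φ Lxx Lxy Lyx Lyy) {p : S → X × Y} (hp : Measurable p)
    (hmem : ∀ s, (p s).1 ∈ effDom f ∧ (p s).2 ∈ effDom g) :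
    Measurable fun s => primalDualGap f g Φ (p s).1 (p s).2 := by
  let Ψ : X × Y → EReal := fun q => ⨆ (u : effDom f) (v : effDom g),
    ((f q.1 + g q.2) + ((Φ q.1 v - (g v).toReal - (f u).toReal - Φ u q.2 : ℝ) : EReal))
  have hΨ : LowerSemicontinuous Ψ := by
    refine lowerSemicontinuous_iSup fun u => lowerSemicontinuous_iSup fun v => ?_
    have h1 : LowerSemicontinuous fun q : X × Y => f q.1 + g q.2 := by
      refine (H.f_convex.lsc.comp continuous_fst).add' (H.g_convex.lsc.comp continuous_snd) ?_
      intro q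
      exact EReal.continuousAt_add (Or.inr (H.g_convex.ne_bot _)) (Or.inl (H.f_convex.ne_bot _))
    refine h1.add' (Continuous.lowerSemicontinuous ?_) ?_
    · have c1 : Continuous fun x => Φ x v := (H.differentiable_x v v.2).continuous
      have c2 : Continuous fun y => Φ u y := (H.differentiable_y u u.2).continuous
      refine continuous_coe_real_ereal.comp ?_
      exact (((c1.comp continuous_fst).sub continuous_const).sub continuous_const).sub
        (c2.comp continuous_snd)
    · intro q
      exact EReal.continuousAt_add (Or.inr (EReal.coe_ne_bot _)) (Or.inr (EReal.coe_ne_top _))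
  have e : (fun s => primalDualGap f g Φ (p s).1 (p s).2) = fun s => (Ψ (p s)).toENNReal := by
    funext s
    rw [primalDualGap, iSup_lagrangian_sub_eq H (hmem s)]
    congr 1
    refine iSup_congr fun u => iSup_congr fun v => ?_
    rw [← H.f_convex.coe_toReal (hmem s).1, ← H.g_convex.coe_toReal (hmem s).2]
    simp only [realLagrangian]
    norm_cast
    ring
  rw [e]
  exact measurable_ereal_toENNReal.comp (hΨ.measurable.comp hp)

end Gap

/-! ### Consequences of the prescribed step sizes. -/

section StepSizes

theorem tauMC_spec {Lxx Lyx δ ε : ℝ} (hxx : 0 ≤ Lxx) (hyx : 0 < Lyx) (hδ : 0 ≤ δ) (hε : 0 < ε) :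
    0 < tauMC Lxx Lyx δ ε ∧ tauMC Lxx Lyx δ ε * (Lyx + Lxx) ≤ 1 ∧
    tauMC Lxx Lyx δ ε * δ ^ 2 ≤ 2 / 15 * ε ∧
    1 / tauMC Lxx Lyx δ ε ≤ (Lyx + Lxx) + 15 / 2 * (δ ^ 2 / ε) := by
  have hL : 0 < Lyx + Lxx := by positivity
  unfold tauMC
  split_ifs with h
  · subst h
    refine ⟨by positivity, by field_simp; rfl, ?_, ?_⟩
    · simp; positivity
    · simp
  · have hδ' : 0 < δ := lt_of_le_of_ne hδ (Ne.symm h)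
    refine ⟨by positivity, ?_, ?_, ?_⟩
    · calc _ ≤ 1 / (Lyx + Lxx) * (Lyx + Lxx) :=
            mul_le_mul_of_nonneg_right (min_le_left _ _) hL.le
        _ = 1 := by field_simp
    · calc _ ≤ 2 / 15 * (ε / δ ^ 2) * δ ^ 2 :=
            mul_le_mul_of_nonneg_right (min_le_right _ _) (sq_nonneg δ)
        _ = 2 / 15 * ε := by field_simp
    · rcases min_choice (1 / (Lyx + Lxx)) (2 / 15 * (ε / δ ^ 2)) with h1 | h1 <;> rw [h1]
      · rw [one_div_one_div]
        have : 0 ≤ 15 / 2 * (δ ^ 2 / ε) := by positivity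
        linarith
      · have : 1 / (2 / 15 * (ε / δ ^ 2)) = 15 / 2 * (δ ^ 2 / ε) := by field_simp
        rw [this]
        linarith

theorem sigmaMC_spec {Lxy Lyx Lyy δ ε : ℝ} (hxy : 0 < Lxy) (hyx : 0 < Lyx) (hyy : 0 ≤ Lyy)
    (hδ : 0 ≤ δ) (hε : 0 < ε) :
    0 < sigmaMC Lxy Lyx Lyy δ ε ∧ sigmaMC Lxy Lyx Lyy δ ε * (Lyx + 2 * Lyy) ≤ 1 ∧
    sigmaMC Lxy Lyx Lyy δ ε * Lxy ≤ 1 ∧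
    sigmaMC Lxy Lyx Lyy δ ε * δ ^ 2 ≤ 1 / 72 * ε ∧
    1 / sigmaMC Lxy Lyx Lyy δ ε ≤ 2 * max (Lyx + Lyy) Lxy + 72 * (δ ^ 2 / ε) := by
  have hL : 0 < Lyx + 2 * Lyy := by positivity
  set m := min (1 / (Lyx + 2 * Lyy)) (1 / Lxy) with hm
  have m_pos : 0 < m := by positivity
  have m1 : m * (Lyx + 2 * Lyy) ≤ 1 :=
    calc _ ≤ 1 / (Lyx + 2 * Lyy) * (Lyx + 2 * Lyy) :=
          mul_le_mul_of_nonneg_right (min_le_left _ _) hL.le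
      _ = 1 := by field_simp
  have m2 : m * Lxy ≤ 1 :=
    calc _ ≤ 1 / Lxy * Lxy := mul_le_mul_of_nonneg_right (min_le_right _ _) hxy.le
      _ = 1 := by field_simp
  -- The factor two accounts for `Lyx + 2 * Lyy ≤ 2 * (Lyx + Lyy)`.
  have m3 : 1 / m ≤ 2 * max (Lyx + Lyy) Lxy := by
    have a1 := le_max_left (Lyx + Lyy) Lxy
    have a2 := le_max_right (Lyx + Lyy) Lxy
    rcases min_choice (1 / (Lyx + 2 * Lyy)) (1 / Lxy) with h1 | h1 <;>
      rw [hm, h1, one_div_one_div] <;> linarith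
  have hmax : 0 < max (Lyx + Lyy) Lxy := lt_max_of_lt_right hxy
  unfold sigmaMC
  split_ifs with h
  · subst h
    refine ⟨m_pos, m1, m2, ?_, ?_⟩
    · simp; positivity
    · rw [zero_pow two_ne_zero, zero_div, mul_zero, add_zero]
      exact m3
  · have hδ' : 0 < δ := lt_of_le_of_ne hδ (Ne.symm h)
    refine ⟨by positivity, ?_, ?_, ?_, ?_⟩
    · exact (mul_le_mul_of_nonneg_right (min_le_left _ _) hL.le).trans m1
    · exact (mul_le_mul_of_nonneg_right (min_le_left _ _) hxy.le).trans m2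
    · calc _ ≤ 1 / 72 * (ε / δ ^ 2) * δ ^ 2 :=
            mul_le_mul_of_nonneg_right (min_le_right _ _) (sq_nonneg δ)
        _ = 1 / 72 * ε := by field_simp
    · rcases min_choice m (1 / 72 * (ε / δ ^ 2)) with h1 | h1 <;> rw [h1]
      · have : 0 ≤ 72 * (δ ^ 2 / ε) := by positivity
        linarith
      · have : 1 / (1 / 72 * (ε / δ ^ 2)) = 72 * (δ ^ 2 / ε) := by field_simp
        rw [this]
        linarith

end StepSizes

theorem sum_Icc_shift {M : Type*} [AddCommMonoid M] (w : ℕ → M) (N : ℕ) :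
    ∑ k ∈ Finset.Icc 1 N, w (k + 1) = ∑ n ∈ Finset.range N, w (n + 2) := by
  induction N with
  | zero => simp
  | succ N ih => rw [Finset.sum_Icc_succ_top (by lia), ih, Finset.sum_range_succ]

/-! ### The expected gap and the iteration count. -/

section Expectation

variable {X Y Wx Wy S : Type*}
  [NormedAddCommGroup X] [InnerProductSpace ℝ X] [FiniteDimensional ℝ X]
  [MeasurableSpace X] [BorelSpace X]
  [NormedAddCommGroup Y] [InnerProductSpace ℝ Y] [FiniteDimensional ℝ Y]
  [MeasurableSpace Y] [BorelSpace Y]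
  [MeasurableSpace Wx] [MeasurableSpace Wy] {mS : MeasurableSpace S}
  {P : Measure S} [IsProbabilityMeasure P]
  {f : X → EReal} {g : Y → EReal} {Φ : X → Y → ℝ} {Lxx Lxy Lyx Lyy Ωf Ωg δx δy τ σ : ℝ}
  {Gx : X → Y → Wx → X} {Gy : X → Y → Wy → Y} {ωx : ℕ → S → Wx} {ωy : ℕ → S → Wy}
  {z : ℕ → S → X × Y} {x₀ : X} {y₀ : Y}

/-- The expected gap after `N` steps, for general admissible step sizes. -/
theorem IsStochasticTrajectory.expectedGap_le
    (T : IsStochasticTrajectory P f g Φ Lxx Lxy Lyx Lyy Ωf Ωg δx δy τ σ Gx Gy ωx ωy x₀ y₀ z)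
    {N : ℕ} (hN : 0 < N) :
    (Measurable fun s => primalDualGap f g Φ (ergodicAverage z N s).1 (ergodicAverage z N s).2) ∧
    expectedGap P f g Φ (fun s => (ergodicAverage z N s).1) (fun s => (ergodicAverage z N s).2)
      ≤ ENNReal.ofReal (5 / 2 * (τ * δx ^ 2) + 21 * (σ * δy ^ 2) + (Ωf / τ + Ωg / σ) / N) := by
  have hN' : (0 : ℝ) < N := by exact_mod_cast hN
  have havg : ∀ s, ergodicAverage z N s
      = (1 / (N : ℝ)) • ∑ n ∈ Finset.range N, z (n + 2) s := fun s => by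
    rw [ergodicAverage, sum_Icc_shift (fun n => z n s)]
  have hmeas : Measurable (ergodicAverage z N) := by
    rw [show ergodicAverage z N = fun s => (1 / (N : ℝ)) • ∑ n ∈ Finset.range N, z (n + 2) s from
      funext havg]
    exact (Finset.measurable_fun_sum _ fun n _ => T.measurable_z' (n + 2)).const_smul (1 / (N : ℝ))
  have hmem : ∀ s, (ergodicAverage z N s).1 ∈ effDom f ∧ (ergodicAverage z N s).2 ∈ effDom g := by
    intro s
    rw [havg]
    have h := lagrangian_gap_average_le T.smooth hN (w := fun n => z (n + 2) s)
      (fun n => T.mem (n + 2) s) (T.mem 0 s).1 (T.mem 0 s).2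
    exact ⟨h.1, h.2.1⟩
  refine ⟨measurable_primalDualGap_comp T.smooth hmeas hmem, ?_⟩
  obtain ⟨B, hB, hle⟩ := T.exists_meanLE_noiseBound N
  have hbound : ∀ s, ∀ u ∈ effDom f, ∀ v ∈ effDom g,
      realLagrangian f g Φ (ergodicAverage z N s).1 v
        - realLagrangian f g Φ u (ergodicAverage z N s).2 ≤ 1 / (N : ℝ) * B s := by
    intro s u hu v hv
    rw [havg]
    exact (lagrangian_gap_le_noiseBound T.smooth T.domains T.compact_f T.compact_g T.τ_pos T.σ_pos
      T.τ_le T.σ_le (T.trajectory s) hu hv hN).trans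
      (mul_le_mul_of_nonneg_left (hle s) (by positivity))
  -- Comparing the average with itself gives gap zero, so the majorant is nonnegative and its lower
  -- integral is its Bochner integral.
  have hnn : ∀ s, 0 ≤ 1 / (N : ℝ) * B s := fun s => by
    simpa using hbound s _ (hmem s).1 _ (hmem s).2
  have hB' := hB.const_mul (by positivity : 0 ≤ 1 / (N : ℝ))
  calc expectedGap P f g Φ (fun s => (ergodicAverage z N s).1) (fun s => (ergodicAverage z N s).2)
      ≤ ∫⁻ s, ENNReal.ofReal (1 / (N : ℝ) * B s) ∂P :=
        lintegral_mono fun s => primalDualGap_le T.smooth (hmem s) (hbound s)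
    _ = ENNReal.ofReal (∫ s, 1 / (N : ℝ) * B s ∂P) :=
        (ofReal_integral_eq_lintegral_ofReal hB'.1 (ae_of_all _ hnn)).symm
    _ ≤ _ := by
        refine ENNReal.ofReal_le_ofReal (hB'.2.trans (le_of_eq ?_))
        field_simp

end Expectation

end SAPD

theorem mainTheorem6 :
    ∃ C : ℝ, 0 < C ∧
      ∀ (X Y Wx Wy S : Type*)
        [NormedAddCommGroup X] [InnerProductSpace ℝ X] [FiniteDimensional ℝ X]
        [MeasurableSpace X] [BorelSpace X]
        [NormedAddCommGroup Y] [InnerProductSpace ℝ Y] [FiniteDimensional ℝ Y]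
        [MeasurableSpace Y] [BorelSpace Y]
        [MeasurableSpace Wx] [MeasurableSpace Wy] [MeasurableSpace S]
        (P : Measure S) [IsProbabilityMeasure P]
        (f : X → EReal) (g : Y → EReal) (Φ : X → Y → ℝ)
        (Lxx Lxy Lyx Lyy Ωf Ωg δx δy ε : ℝ)
        (Gx : X → Y → Wx → X) (Gy : X → Y → Wy → Y)
        (ωx : ℕ → S → Wx) (ωy : ℕ → S → Wy) (x₀ : X) (y₀ : Y) (τ σ θ : ℝ)
        (z : ℕ → S → X × Y),
        SAPD.IsSmoothConvexConcave f g Φ Lxx Lxy Lyx Lyy →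
        SAPD.HasCompactDomains f g Ωf Ωg →
        x₀ ∈ SAPD.effDom f → y₀ ∈ SAPD.effDom g →
        0 < ε →
        τ = SAPD.tauMC Lxx Lyx δx ε →
        σ = SAPD.sigmaMC Lxy Lyx Lyy δy ε →
        θ = 1 →
        z = SAPD.process f g Gx Gy τ σ θ x₀ y₀ ωx ωy →
        SAPD.IsUnbiasedBoundedNoise P Φ Gx Gy ωx ωy z δx δy →
        ∀ N : ℕ,
          C * (((Lyx + Lxx) * Ωf + max (Lyx + Lyy) Lxy * Ωg) / ε
              + (δx ^ 2 * Ωf + δy ^ 2 * Ωg) / ε ^ 2) ≤ (N : ℝ) →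
          AEMeasurable (fun s => SAPD.primalDualGap f g Φ
              (SAPD.ergodicAverage z N s).1 (SAPD.ergodicAverage z N s).2) P ∧
          SAPD.expectedGap P f g Φ
              (fun s => (SAPD.ergodicAverage z N s).1)
              (fun s => (SAPD.ergodicAverage z N s).2) ≤ ENNReal.ofReal ε := by
  -- The largest constant in the bounds on `1 / τ` and `1 / σ` is `72`, so `1000` leaves `72/1000 *
  -- ε` for the distance terms. With noise at most `(5/2 * 2/15 + 21/72) * ε = 5/8 * ε`, the total
  -- stays below `ε`.
  refine ⟨1000, by norm_num, ?_⟩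
  intro X Y Wx Wy S _ _ _ _ _ _ _ _ _ _ _ _ _ P _ f g Φ Lxx Lxy Lyx Lyy Ωf Ωg δx δy ε Gx Gy ωx ωy
    x₀ y₀ τ σ θ z H K hx hy hε hτ hσ hθ hz hn N hN
  obtain ⟨τ_pos, τ_le, τ_noise, τ_inv⟩ :=
    SAPD.tauMC_spec H.Lxx_nonneg H.Lyx_pos hn.δx_nonneg hε
  obtain ⟨σ_pos, σ_le, σ_le', σ_noise, σ_inv⟩ :=
    SAPD.sigmaMC_spec H.Lxy_pos H.Lyx_pos H.Lyy_nonneg hn.δy_nonneg hε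
  rw [← hτ] at τ_pos τ_le τ_noise τ_inv
  rw [← hσ] at σ_pos σ_le σ_le' σ_noise σ_inv
  have cf : IsCompact (SAPD.effDom f) := by
    have := K.compact.image continuous_fst
    rwa [fst_image_prod _ ⟨y₀, hy⟩] at this
  have cg : IsCompact (SAPD.effDom g) := by
    have := K.compact.image continuous_snd
    rwa [snd_image_prod ⟨x₀, hx⟩] at this
  rw [hθ] at hz
  have T : SAPD.IsStochasticTrajectory P f g Φ Lxx Lxy Lyx Lyy Ωf Ωg δx δy τ σ Gx Gy ωx ωy
      x₀ y₀ z :=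
    ⟨H, K, cf, cg, τ_pos, σ_pos, τ_le, σ_le, σ_le', by rw [hz]; rfl,
      SAPD.isTrajectory_process hx hy hz, hn⟩
  have hΩf := K.Ωf_pos
  have hΩg := K.Ωg_pos
  have hLxx := H.Lxx_nonneg
  have hLyx := H.Lyx_pos
  have hmax : 0 < max (Lyx + Lyy) Lxy := lt_max_of_lt_right H.Lxy_pos
  have hN_pos : (0 : ℝ) < N := lt_of_lt_of_le (by positivity) hN
  obtain ⟨hmeas, hgap⟩ := T.expectedGap_le (N := N) (by exact_mod_cast hN_pos)
  refine ⟨hmeas.aemeasurable, hgap.trans (ENNReal.ofReal_le_ofReal ?_)⟩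
  have hdist : (Ωf / τ + Ωg / σ) / N ≤ 72 / 1000 * ε := by
    rw [div_le_iff₀ hN_pos]
    have a1 := mul_le_mul_of_nonneg_left τ_inv hΩf.le
    have a2 := mul_le_mul_of_nonneg_left σ_inv hΩg.le
    have a3 := mul_le_mul_of_nonneg_left hN (by positivity : 0 ≤ 72 / 1000 * ε)
    have e : 72 / 1000 * ε * (1000 * (((Lyx + Lxx) * Ωf + max (Lyx + Lyy) Lxy * Ωg) / ε
        + (δx ^ 2 * Ωf + δy ^ 2 * Ωg) / ε ^ 2))
        = 72 * ((Lyx + Lxx) * Ωf) + 72 * (max (Lyx + Lyy) Lxy * Ωg)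
          + 72 * (Ωf * (δx ^ 2 / ε)) + 72 * (Ωg * (δy ^ 2 / ε)) := by
      field_simp
      ring
    rw [e] at a3
    rw [mul_one_div] at a1 a2
    have b1 : 0 ≤ (Lyx + Lxx) * Ωf := by positivity
    have b2 : 0 ≤ max (Lyx + Lyy) Lxy * Ωg := by positivity
    have b3 : 0 ≤ Ωf * (δx ^ 2 / ε) := by positivity
    linarith
  linarith
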